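/- **Setting.** Let $T>0$, let $A:[0,T]\to\mathbb C^{n\times n}$ be continuous, $A=H_1+iH_2$ with $H_1=(A+A^\dagger)/2$, $H_2=(A-A^\dagger)/(2i)$, and let $u$ solve $\frac{d}{dt}u=A(t)u$ on $[0,T]$, $u(0)=u_0\in\mathbb C^n$. Put $$\lambda^{\pm}=\max\Big\{\sup_{0<t<T}\{|\lambda|:\lambda\in\sigma(H_1(t)),\ \pm\lambda>0\},\,0\Big\}.$$ Let $L>0$, let $N_p$ be a positive even integer, $\triangle p=2\pi L/N_p$, $p_j=-\pi L+j\triangle p$, $\mu_l=(l-N_p/2)/L$, $\phi_l(p)=e^{i\mu_l(p+\pi L)}$ for $j,l\in\{0,\dots,N_p-1\}$, $\Phi=(\phi_l(p_j))_{j,l}$ and $D_p=\mathrm{diag}(\mu_0,\dots,\mu_{N_p-1})$. Let $\tilde w_h$ solve the discrete Schrödingerized system $$\tfrac{d}{dt}\tilde w_h=-i\,(D_p\otimes H_1-I\otimes H_2)\,\tilde w_h\ \text{ on }[0,T],\qquad \tilde w_h(0)=(\Phi^{-1}\otimes I)\,w_h(0),\qquad w_h(0)=\sum_{k=0}^{N_p-1}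 e^{-|p_k|}\,|k\rangle\otimes u_0,$$ and put $$w_h^d(t,p)=\sum_{l=0}^{N_p-1}\phi_l(p)\,(\langle l|\otimes I)\tilde w_h(t),\qquad u_h^d(t,p)=e^{p}\,w_h^d(t,p).$$ **Theorem 4.4.** For all real $M,\Lambda$ there is a constant $C>0$, depending only on $M$ and $\Lambda$, such that the following holds for all data as above. Let $R\ge 1$ with $e^R\le M$, let $p^\Diamond\ge\lambda^+T$ with $e^{p^\Diamond-\lambda^+T}\le M$, let $\lambda^-T\le\Lambda$, and suppose that $\pi L$ is so large that $$e^{-\pi L+2\lambda^+T+R}\le\epsilon,\qquad e^{-\pi L+\lambda^-T+\lambda^+T+R}\le\epsilon .$$ Then $$\|u_h^d(T,\cdot)-u(T)\|_{L^2((p^\Diamond,\,p^\Diamond+R))}\le C\big(\triangle p\,e^{p^\Diamond}\|u(T)\|+\epsilon\,\|u_0\|\big).$$ In particular $C$ does not depend on $n$, $u_0$, $L$, $N_p$, $\epsilon$ or $\lambda^+$. -/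

import Mathlib

open scoped Kronecker
open Real MeasureTheory Matrix

noncomputable section

namespace Schrodingerization

/-- Hermitian part `H₁ = (A + A†)/2`. -/
def H1 {n : ℕ} (A : Matrix (Fin n) (Fin n) ℂ) : Matrix (Fin n) (Fin n) ℂ :=
  (1 / 2 : ℂ) • (A + Aᴴ)

/-- `H₂ = (A - A†)/(2i)`. -/
def H2 {n : ℕ} (A : Matrix (Fin n) (Fin n) ℂ) : Matrix (Fin n) (Fin n) ℂ :=
  (1 / (2 * Complex.I)) • (A - Aᴴ)

/-- The decomposition `A = H₁ + i H₂`. -/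
theorem H1_add_I_smul_H2 {n : ℕ} (A : Matrix (Fin n) (Fin n) ℂ) :
    H1 A + Complex.I • H2 A = A := by
  have h : Complex.I * (1 / (2 * Complex.I)) = 1 / 2 := by
    field_simp [Complex.I_ne_zero]
  rw [H1, H2, smul_smul, h, ← smul_add]
  ext i j
  simp
  ring

/-- `λ⁺_max(H₁) = max { sup_{0<t<T} { |λ| : λ ∈ σ(H₁(t)), λ > 0 }, 0 }`. -/
def lamPlus {n : ℕ} (A : ℝ → Matrix (Fin n) (Fin n) ℂ) (T : ℝ) : ℝ :=
  max (sSup {x : ℝ | ∃ t ∈ Set.Ioo 0 T, ∃ lam ∈ spectrum ℝ (H1 (A t)), 0 < lam ∧ x = |lam|}) 0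

/-- `λ⁻_max(H₁) = max { sup_{0<t<T} { |λ| : λ ∈ σ(H₁(t)), λ < 0 }, 0 }`. -/
def lamMinus {n : ℕ} (A : ℝ → Matrix (Fin n) (Fin n) ℂ) (T : ℝ) : ℝ :=
  max (sSup {x : ℝ | ∃ t ∈ Set.Ioo 0 T, ∃ lam ∈ spectrum ℝ (H1 (A t)), lam < 0 ∧ x = |lam|}) 0

/-- `u` is a (classical) solution of `du/dt = A(t) u` on `[0,T]` with `u(0) = u₀`. -/
def IsODESolution {n : ℕ} (A : ℝ → Matrix (Fin n) (Fin n) ℂ) (T : ℝ)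
    (u₀ : EuclideanSpace ℂ (Fin n)) (u : ℝ → EuclideanSpace ℂ (Fin n)) : Prop :=
  u 0 = u₀ ∧
    ∀ t ∈ Set.Icc 0 T,
      HasDerivWithinAt u (WithLp.toLp 2 (A t *ᵥ (u t).ofLp)) (Set.Icc 0 T) t

/-- Mesh size `Δp = 2πL / N_p`. -/
def meshSize (L : ℝ) (N : ℕ) : ℝ := 2 * π * L / N

/-- Grid points `p_j = -πL + j Δp`. -/
def gridPoint (L : ℝ) (N : ℕ) (j : Fin N) : ℝ := -(π * L) + (j : ℝ) * meshSize L N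

/-- Frequencies `μ_l = (l - N_p/2)/L`. -/
def freq (L : ℝ) (N : ℕ) (l : Fin N) : ℝ := ((l : ℝ) - (N : ℝ) / 2) / L

/-- Basis functions `φ_l(p) = exp(i μ_l (p + πL))`. -/
def basisFun (L : ℝ) (N : ℕ) (l : Fin N) (p : ℝ) : ℂ :=
  Complex.exp (Complex.I * ((freq L N l * (p + π * L) : ℝ) : ℂ))

/-- The matrix `Φ = (φ_l(p_j))_{j,l}`. -/
def Phi (L : ℝ) (N : ℕ) : Matrix (Fin N) (Fin N) ℂ :=
  Matrix.of fun j l => basisFun L N l (gridPoint L N j)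

/-- `D_p = diag(μ_0, …, μ_{N_p-1})`. -/
def Dp (L : ℝ) (N : ℕ) : Matrix (Fin N) (Fin N) ℂ :=
  Matrix.diagonal fun l => (freq L N l : ℂ)

/-- The discrete Hamiltonian `H^d = D_p ⊗ H₁ - I ⊗ H₂`. -/
def Hd {n : ℕ} (L : ℝ) (N : ℕ) (A : Matrix (Fin n) (Fin n) ℂ) :
    Matrix (Fin N × Fin n) (Fin N × Fin n) ℂ :=
  Dp L N ⊗ₖ H1 A - (1 : Matrix (Fin N) (Fin N) ℂ) ⊗ₖ H2 A

/-- Grid values of the initial data `e^{-|p|} u₀`. -/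
def initialGrid {n : ℕ} (L : ℝ) (N : ℕ) (u₀ : EuclideanSpace ℂ (Fin n)) : Fin N × Fin n → ℂ :=
  fun kj => (Real.exp (-|gridPoint L N kj.1|) : ℂ) * u₀ kj.2

/-- `w` (the vector of discrete Fourier coefficients) solves
`dw/dt = -i H^d(t) w` on `[0,T]`, `w(0) = (Φ⁻¹ ⊗ I) w_h(0)`. -/
def IsDiscreteSolution {n : ℕ} (A : ℝ → Matrix (Fin n) (Fin n) ℂ) (T L : ℝ) (N : ℕ)
    (u₀ : EuclideanSpace ℂ (Fin n)) (w : ℝ → Fin N × Fin n → ℂ) : Prop :=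
  w 0 = ((Phi L N)⁻¹ ⊗ₖ (1 : Matrix (Fin n) (Fin n) ℂ)) *ᵥ initialGrid L N u₀ ∧
    ∀ t ∈ Set.Icc 0 T,
      HasDerivWithinAt w ((-Complex.I) • (Hd L N (A t) *ᵥ w t)) (Set.Icc 0 T) t

/-- The trigonometric polynomial `w_h^d(p) = ∑_l φ_l(p) (⟨l| ⊗ I) w` with coefficient vector `w`. -/
def whd {n : ℕ} (L : ℝ) (N : ℕ) (w : Fin N × Fin n → ℂ) (p : ℝ) : EuclideanSpace ℂ (Fin n) :=
  ∑ l : Fin N, basisFun L N l p • WithLp.toLp 2 fun j => w (l, j)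

/-- The recovered approximation `u_h^d(p) = e^p w_h^d(p)`. -/
def uhd {n : ℕ} (L : ℝ) (N : ℕ) (w : Fin N × Fin n → ℂ) (p : ℝ) : EuclideanSpace ℂ (Fin n) :=
  (Real.exp p : ℂ) • whd L N w p

end Schrodingerization

end

/-!
The trigonometric polynomial `w_h^d(t, p)` solves the hyperbolic system
`∂ₜw = -H₁ ∂ₚw + i H₂ w` exactly, and so does `e^{-p} u(t)`; the only discretization error is that of
the initial data. Hence `D = w_h^d - e^{-p} u` obeys the energy estimate on the shrinking interval
`(q₀ + λ⁺ t, q₁ - λ⁻ t)` (`integral_norm_sq_le_of_hyperbolic`): the boundary terms have a sign because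
`-λ⁻ ≤ H₁ ≤ λ⁺` there. Its norm on `(pD, pD + R)` at time `T` is therefore at most the norm at
time `0` on `(pD - λ⁺T, pD + R + λ⁻T)`.

If this interval lies in `[0, πL]`, where `e^{-|p|} = e^{-p}`, what remains is the interpolation error
of `e^{-|p|}` (`integral_interp_error_le`). It vanishes at the left end of each grid cell, so by
Poincaré's inequality it is at most `Δp` times the norm of its derivative. The derivative of
the interpolant is controlled by the increments of `e^{-|p|}` along the grid through the discrete and
continuous Parseval identities and `|e^{iμΔp} - 1| ≥ (2/π)|μ|Δp`, valid since `|μ_l| Δp ≤ π`. Finally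
`‖u₀‖ ≤ e^{λ⁻T} ‖u(T)‖` replaces `u₀` by `u(T)`.

If the interval leaves `[0, πL]`, the assumption on `πL` forces `ε ≥ c e^{λ⁺T}` with `c` depending
only on `M` and `Λ`, and crude bounds suffice: each Fourier mode evolves unitarily
(`integral_whd_le`), and `‖u(T)‖ ≤ e^{λ⁺T} ‖u₀‖`.
-/

namespace Schrodingerization

/-! ### The energy estimate on a shrinking interval -/

section Energy

variable {V : Type*} [NormedAddCommGroup V] [InnerProductSpace ℂ V] {ι : Type*} [Fintype ι]

theorem inner_sum_smul_sum_smul (c e : ι → ℂ) (x y : ι → V) :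
    inner ℂ (∑ m, c m • x m) (∑ m, e m • y m) =
      ∑ m, ∑ k, inner ℂ (x m) (y k) * (starRingEnd ℂ (c m) * e k) := by
  rw [sum_inner]
  refine Finset.sum_congr rfl fun m _ => ?_
  rw [inner_sum]
  refine Finset.sum_congr rfl fun k _ => ?_
  rw [inner_smul_left, inner_smul_right]
  ring

theorem integral_inner_sum_smul {ψ : ι → ℝ → ℂ} (hψ : ∀ m, Continuous (ψ m)) (x y : ι → V)
    (a b : ℝ) :
    ∫ p in a..b, inner ℂ (∑ m, ψ m p • x m) (∑ m, ψ m p • y m) =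
      ∑ m, ∑ k, inner ℂ (x m) (y k) * ∫ p in a..b, starRingEnd ℂ (ψ m p) * ψ k p := by
  have hc : ∀ m k, Continuous fun p => starRingEnd ℂ (ψ m p) * ψ k p := fun m k =>
    (Complex.continuous_conj.comp (hψ m)).mul (hψ k)
  simp only [inner_sum_smul_sum_smul]
  rw [intervalIntegral.integral_finsetSum]
  · refine Finset.sum_congr rfl fun m _ => ?_
    rw [intervalIntegral.integral_finsetSum]
    · simp only [intervalIntegral.integral_const_mul]
    · exact fun k _ => ((hc m k).const_mul _).intervalIntegrable _ _
  · exact fun m _ =>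
      (continuous_finsetSum _ fun k _ => (hc m k).const_mul _).intervalIntegrable _ _

theorem hasDerivAt_integral_affine_bounds {f : ℝ → ℂ} (hf : Continuous f) (a α b β t : ℝ) :
    HasDerivAt (fun s => ∫ p in (a + α * s)..(b + β * s), f p)
      ((β : ℂ) * f (b + β * t) - (α : ℂ) * f (a + α * t)) t := by
  have key : ∀ c γ : ℝ, HasDerivAt (fun s => ∫ p in (0 : ℝ)..(c + γ * s), f p)
      ((γ : ℂ) * f (c + γ * t)) t := by
    intro c γ
    have h1 : HasDerivAt (fun s : ℝ => c + γ * s) γ t := by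
      simpa using ((hasDerivAt_id t).const_mul γ).const_add c
    have h2 := (hf.integral_hasStrictDerivAt 0 (c + γ * t)).hasDerivAt
    have h3 := h2.scomp t h1
    simpa [Function.comp_def] using h3
  have h := (key b β).sub (key a α)
  refine h.congr_of_eventuallyEq (Filter.Eventually.of_forall fun s => ?_)
  exact (intervalIntegral.integral_interval_sub_left (hf.intervalIntegrable _ _)
    (hf.intervalIntegrable _ _)).symm

/-- Energy estimate for the symmetric hyperbolic system `∂ₜD = -S(t) ∂ₚD + K(t) D`, where `S` is
symmetric with spectrum in `[-lm, lp]` and `K` is skew: the energy on the interval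
`(q₀ + lp t, q₁ - lm t)`, whose endpoints move inwards at least as fast as the characteristics, does
not grow. It is stated for finite sums of separated solutions `ψₘ(p) dₘ(t)` with `ψₘ' = νₘ ψₘ`, so
that the time derivative of the energy is a finite sum. -/
theorem integral_norm_sq_le_of_hyperbolic {ψ : ι → ℝ → ℂ} {ν : ι → ℂ}
    (hψ : ∀ m p, HasDerivAt (ψ m) (ν m * ψ m p) p) {T : ℝ} (hT : 0 ≤ T) {d : ι → ℝ → V}
    {S K : ℝ → V →L[ℂ] V}
    (hd : ∀ m, ∀ t ∈ Set.Icc 0 T,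
      HasDerivWithinAt (d m) (-(ν m • S t (d m t)) + K t (d m t)) (Set.Icc 0 T) t)
    (hS : ∀ t x y, inner ℂ (S t x) y = inner ℂ x (S t y))
    (hK : ∀ t x y, inner ℂ (K t x) y = -inner ℂ x (K t y)) {lp lm : ℝ}
    (hup : ∀ t ∈ Set.Ioo 0 T, ∀ x, (inner ℂ x (S t x)).re ≤ lp * ‖x‖ ^ 2)
    (hlow : ∀ t ∈ Set.Ioo 0 T, ∀ x, -(lm * ‖x‖ ^ 2) ≤ (inner ℂ x (S t x)).re) (q₀ q₁ : ℝ) :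
    ∫ p in (q₀ + lp * T)..(q₁ - lm * T), ‖∑ m, ψ m p • d m T‖ ^ 2 ≤
      ∫ p in q₀..q₁, ‖∑ m, ψ m p • d m 0‖ ^ 2 := by
  have hcont : ∀ m, Continuous (ψ m) := fun m =>
    continuous_iff_continuousAt.2 fun p => (hψ m p).continuousAt
  set D : ℝ → ℝ → V := fun t p => ∑ m, ψ m p • d m t with hD
  have hDcont : ∀ t, Continuous (D t) := fun t =>
    continuous_finsetSum _ fun m _ => (hcont m).smul continuous_const
  set F : ℝ → ℂ := fun t => ∫ p in (q₀ + lp * t)..(q₁ + (-lm) * t), inner ℂ (D t p) (D t p) with hF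
  have hFre : ∀ t, (F t).re = ∫ p in (q₀ + lp * t)..(q₁ + (-lm) * t), ‖D t p‖ ^ 2 := by
    intro t
    have : F t = ((∫ p in (q₀ + lp * t)..(q₁ + (-lm) * t), ‖D t p‖ ^ 2 : ℝ) : ℂ) := by
      rw [← intervalIntegral.integral_ofReal, hF]
      refine intervalIntegral.integral_congr fun p _ => ?_
      simp only [inner_self_eq_norm_sq_to_K]
      simp
    rw [this, Complex.ofReal_re]
  have hderiv : ∀ t ∈ Set.Icc 0 T, HasDerivWithinAt F
      (-(inner ℂ (D t (q₁ + (-lm) * t)) (S t (D t (q₁ + (-lm) * t)))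
          - inner ℂ (D t (q₀ + lp * t)) (S t (D t (q₀ + lp * t))))
        + (((-lm : ℝ) : ℂ) * inner ℂ (D t (q₁ + (-lm) * t)) (D t (q₁ + (-lm) * t))
          - (lp : ℂ) * inner ℂ (D t (q₀ + lp * t)) (D t (q₀ + lp * t)))) (Set.Icc 0 T) t := by
    intro t ht
    set d' : ι → V := fun m => -(ν m • S t (d m t)) + K t (d m t) with hd'
    have hexp : F = fun s => ∑ m, ∑ k, inner ℂ (d m s) (d k s) *
        ∫ p in (q₀ + lp * s)..(q₁ + (-lm) * s), starRingEnd ℂ (ψ m p) * ψ k p := by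
      funext s
      exact integral_inner_sum_smul hcont _ _ _ _
    have h1 : HasDerivWithinAt F (∑ m, ∑ k,
        ((inner ℂ (d m t) (d' k) + inner ℂ (d' m) (d k t)) *
          (∫ p in (q₀ + lp * t)..(q₁ + (-lm) * t), starRingEnd ℂ (ψ m p) * ψ k p)
        + inner ℂ (d m t) (d k t) *
          (((-lm : ℝ) : ℂ) * (starRingEnd ℂ (ψ m (q₁ + (-lm) * t)) * ψ k (q₁ + (-lm) * t))
            - (lp : ℂ) * (starRingEnd ℂ (ψ m (q₀ + lp * t)) * ψ k (q₀ + lp * t)))))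
        (Set.Icc 0 T) t := by
      rw [hexp]
      refine HasDerivWithinAt.fun_sum fun m _ => HasDerivWithinAt.fun_sum fun k _ => ?_
      refine HasDerivWithinAt.mul (HasDerivWithinAt.inner ℂ (hd m t ht) (hd k t ht)) ?_
      exact (hasDerivAt_integral_affine_bounds
        ((Complex.continuous_conj.comp (hcont m)).mul (hcont k)) _ _ _ _ t).hasDerivWithinAt
    convert h1 using 1
    simp only [add_mul, mul_sub, Finset.sum_add_distrib, Finset.sum_sub_distrib]
    rw [← integral_inner_sum_smul hcont, ← integral_inner_sum_smul hcont]
    have hb : ∀ (γ : ℂ) (p : ℝ), ∑ m, ∑ k, inner ℂ (d m t) (d k t) *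
        (γ * (starRingEnd ℂ (ψ m p) * ψ k p)) = γ * inner ℂ (D t p) (D t p) := by
      intro γ p
      rw [hD, inner_sum_smul_sum_smul, Finset.mul_sum]
      refine Finset.sum_congr rfl fun m _ => ?_
      rw [Finset.mul_sum]
      exact Finset.sum_congr rfl fun k _ => by ring
    rw [hb, hb]
    congr 1
    -- the `p`-derivative of the flux `⟪D, S D⟫` is minus the time derivative of `‖D‖²`
    have hDp : ∀ p, HasDerivAt (D t) (∑ m, (ν m * ψ m p) • d m t) p := fun p =>
      HasDerivAt.fun_sum fun m _ => (hψ m p).smul_const _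
    have hc1 : Continuous fun p => ∑ m, ψ m p • d' m :=
      continuous_finsetSum _ fun m _ => (hcont m).smul continuous_const
    have hflux : ∀ p, HasDerivAt (fun p => -inner ℂ (D t p) (S t (D t p)))
        (inner ℂ (∑ m, ψ m p • d m t) (∑ m, ψ m p • d' m)
          + inner ℂ (∑ m, ψ m p • d' m) (∑ m, ψ m p • d m t)) p := by
      intro p
      have h2 : HasDerivAt (fun p => S t (D t p)) (S t (∑ m, (ν m * ψ m p) • d m t)) p :=
        ((S t).restrictScalars ℝ).hasFDerivAt.comp_hasDerivAt p (hDp p)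
      have h3 := (HasDerivAt.inner ℂ (hDp p) h2).fun_neg
      refine h3.congr_deriv ?_
      have h4 : ∑ m, ψ m p • d' m = -S t (∑ m, (ν m * ψ m p) • d m t) + K t (D t p) := by
        simp only [hd', hD, map_sum, map_smul, smul_add, smul_neg, Finset.sum_add_distrib,
          Finset.sum_neg_distrib, smul_smul, mul_comm]
      change _ = inner ℂ (D t p) _ + inner ℂ _ (D t p)
      rw [h4, inner_add_left, inner_add_right, inner_neg_left, inner_neg_right, hS, hK]
      ring
    rw [← intervalIntegral.integral_add, intervalIntegral.integral_eq_sub_of_hasDerivAt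
      (fun p _ => hflux p)]
    · ring
    · exact (((hDcont t).inner hc1).add (hc1.inner (hDcont t))).intervalIntegrable _ _
    · exact ((hDcont t).inner hc1).intervalIntegrable _ _
    · exact (hc1.inner (hDcont t)).intervalIntegrable _ _
  have hre : ∀ t ∈ Set.Icc 0 T, HasDerivWithinAt (fun t => (F t).re) _ (Set.Icc 0 T) t :=
    fun t ht => (Complex.reCLM.hasFDerivAt.comp_hasDerivWithinAt t (hderiv t ht))
  have hanti : AntitoneOn (fun t => (F t).re) (Set.Icc 0 T) := by
    refine antitoneOn_of_hasDerivWithinAt_nonpos (convex_Icc 0 T)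
      (fun t ht => (hre t ht).continuousWithinAt)
      (fun t ht => (hre t (interior_subset ht)).mono interior_subset) fun t ht => ?_
    rw [interior_Icc] at ht
    have e1 := hup t ht (D t (q₀ + lp * t))
    have e2 := hlow t ht (D t (q₁ + (-lm) * t))
    have e3 : ∀ x : V, inner ℂ x x = ((‖x‖ ^ 2 : ℝ) : ℂ) := fun x => by
      rw [inner_self_eq_norm_sq_to_K]; simp
    rw [e3, e3]
    simp only [Complex.reCLM_apply, Complex.add_re, Complex.sub_re, Complex.neg_re,
      ← Complex.ofReal_mul, Complex.ofReal_re]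
    linarith
  have h := hanti (Set.left_mem_Icc.2 hT) (Set.right_mem_Icc.2 hT) hT
  simp only [hFre] at h
  simpa [sub_eq_add_neg] using h

end Energy

/-! ### Numerical range of the Hermitian part -/

open scoped ComplexOrder in
theorem re_inner_toEuclideanCLM_le {n : ℕ} {B : Matrix (Fin n) (Fin n) ℂ} (hB : B.IsHermitian)
    {c : ℝ} (h : ∀ lam ∈ spectrum ℝ B, lam ≤ c) (x : EuclideanSpace ℂ (Fin n)) :
    (inner ℂ x (toEuclideanCLM (𝕜 := ℂ) B x)).re ≤ c * ‖x‖ ^ 2 := by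
  have hC : (algebraMap ℝ (Matrix (Fin n) (Fin n) ℂ) c - B).IsHermitian := by
    refine IsHermitian.sub ?_ hB
    rw [Algebra.algebraMap_eq_smul_one]
    simp [IsHermitian, conjTranspose_smul]
  have hpos : (algebraMap ℝ (Matrix (Fin n) (Fin n) ℂ) c - B).PosSemidef := by
    refine hC.posSemidef_iff_eigenvalues_nonneg.2 fun i => ?_
    have hi := hC.eigenvalues_mem_spectrum_real i
    rw [← spectrum.singleton_sub_eq] at hi
    obtain ⟨r, hr, s, hs, hrs⟩ := Set.mem_sub.1 hi
    rw [Set.mem_singleton_iff] at hr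
    have := h s hs
    simp only [Pi.zero_apply]
    linarith
  have h1 := (posSemidef_iff_dotProduct_mulVec.1 hpos).2 x.ofLp
  have h2 : star x.ofLp ⬝ᵥ (algebraMap ℝ (Matrix (Fin n) (Fin n) ℂ) c - B) *ᵥ x.ofLp
      = ((c * ‖x‖ ^ 2 : ℝ) : ℂ) - inner ℂ x (toEuclideanCLM (𝕜 := ℂ) B x) := by
    rw [sub_mulVec, dotProduct_sub, EuclideanSpace.inner_eq_star_dotProduct]
    congr 1
    · rw [Algebra.algebraMap_eq_smul_one, smul_mulVec, one_mulVec, dotProduct_smul, dotProduct_comm,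
        ← EuclideanSpace.inner_eq_star_dotProduct, inner_self_eq_norm_sq_to_K]
      simp
    · rw [dotProduct_comm]; rfl
  rw [h2] at h1
  have := (Complex.le_def.1 h1).1
  simp only [Complex.zero_re, Complex.sub_re, Complex.ofReal_re] at this
  linarith

theorem le_re_inner_toEuclideanCLM {n : ℕ} {B : Matrix (Fin n) (Fin n) ℂ} (hB : B.IsHermitian)
    {c : ℝ} (h : ∀ lam ∈ spectrum ℝ B, -c ≤ lam) (x : EuclideanSpace ℂ (Fin n)) :
    -(c * ‖x‖ ^ 2) ≤ (inner ℂ x (toEuclideanCLM (𝕜 := ℂ) B x)).re := by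
  have h1 := re_inner_toEuclideanCLM_le hB.neg (c := c) (fun lam hl => ?_) x
  · rw [map_neg, _root_.neg_apply, inner_neg_right, Complex.neg_re] at h1
    linarith
  · rw [← spectrum.neg_eq, Set.mem_neg] at hl
    linarith [h _ hl]

theorem isHermitian_H1 {n : ℕ} (A : Matrix (Fin n) (Fin n) ℂ) : (H1 A).IsHermitian := by
  simp [IsHermitian, H1, conjTranspose_smul, add_comm]

theorem isHermitian_H2 {n : ℕ} (A : Matrix (Fin n) (Fin n) ℂ) : (H2 A).IsHermitian := by
  simp only [IsHermitian, H2, conjTranspose_smul, conjTranspose_sub, conjTranspose_conjTranspose]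
  rw [← neg_sub Aᴴ A, smul_neg, ← neg_smul]
  congr 1
  simp

section Bounds

attribute [local instance] Matrix.linftyOpNormedRing Matrix.linftyOpNormedAlgebra

/-- The eigenvalues of `H₁(t)`, `0 ≤ t ≤ T`, are uniformly bounded, so that the suprema in `lamPlus`
and `lamMinus` are genuine ones. -/
theorem exists_bound_spectrum_H1 {n : ℕ} {A : ℝ → Matrix (Fin n) (Fin n) ℂ} {T : ℝ}
    (hA : ContinuousOn A (Set.Icc 0 T)) :
    ∃ B : ℝ, ∀ t ∈ Set.Icc 0 T, ∀ lam ∈ spectrum ℝ (H1 (A t)), |lam| ≤ B := by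
  have hc : ContinuousOn (fun t => ‖H1 (A t)‖) (Set.Icc 0 T) := by
    have h1 : ContinuousOn (fun t => H1 (A t)) (Set.Icc 0 T) := by
      have h2 : Continuous fun X : Matrix (Fin n) (Fin n) ℂ => H1 X := by
        unfold H1
        fun_prop
      exact h2.comp_continuousOn hA
    exact continuous_norm.comp_continuousOn h1
  obtain ⟨B, hB⟩ := (isCompact_Icc.bddAbove_image hc)
  refine ⟨B * ‖(1 : Matrix (Fin n) (Fin n) ℂ)‖, fun t ht lam hl => ?_⟩
  have h1 := spectrum.norm_le_norm_mul_of_mem hl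
  have h2 : ‖H1 (A t)‖ ≤ B := hB ⟨t, ht, rfl⟩
  rw [Real.norm_eq_abs] at h1
  exact h1.trans (mul_le_mul_of_nonneg_right h2 (norm_nonneg _))

end Bounds

theorem re_inner_H1_le_lamPlus {n : ℕ} {A : ℝ → Matrix (Fin n) (Fin n) ℂ} {T : ℝ}
    (hA : ContinuousOn A (Set.Icc 0 T)) {t : ℝ} (ht : t ∈ Set.Ioo 0 T)
    (x : EuclideanSpace ℂ (Fin n)) :
    (inner ℂ x (toEuclideanCLM (𝕜 := ℂ) (H1 (A t)) x)).re ≤ lamPlus A T * ‖x‖ ^ 2 := by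
  refine re_inner_toEuclideanCLM_le (isHermitian_H1 _) (fun lam hl => ?_) x
  obtain ⟨B, hB⟩ := exists_bound_spectrum_H1 hA
  rcases le_or_gt lam 0 with h | h
  · exact h.trans (le_max_right _ _)
  · refine (le_abs_self lam).trans (le_max_of_le_left (le_csSup (a := |lam|) ⟨B, ?_⟩
      ⟨t, ht, lam, hl, h, rfl⟩))
    rintro _ ⟨s, hs, l, hl, -, rfl⟩
    exact hB s (Set.Ioo_subset_Icc_self hs) l hl

theorem neg_lamMinus_le_re_inner_H1 {n : ℕ} {A : ℝ → Matrix (Fin n) (Fin n) ℂ} {T : ℝ}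
    (hA : ContinuousOn A (Set.Icc 0 T)) {t : ℝ} (ht : t ∈ Set.Ioo 0 T)
    (x : EuclideanSpace ℂ (Fin n)) :
    -(lamMinus A T * ‖x‖ ^ 2) ≤ (inner ℂ x (toEuclideanCLM (𝕜 := ℂ) (H1 (A t)) x)).re := by
  refine le_re_inner_toEuclideanCLM (isHermitian_H1 _) (fun lam hl => ?_) x
  obtain ⟨B, hB⟩ := exists_bound_spectrum_H1 hA
  rcases le_or_gt 0 lam with h | h
  · have : 0 ≤ lamMinus A T := le_max_right _ _
    linarith
  · rw [neg_le]
    refine (neg_le_abs lam).trans (le_max_of_le_left (le_csSup (a := |lam|) ⟨B, ?_⟩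
      ⟨t, ht, lam, hl, h, rfl⟩))
    rintro _ ⟨s, hs, l, hl, -, rfl⟩
    exact hB s (Set.Ioo_subset_Icc_self hs) l hl

theorem inner_toEuclideanCLM_of_isHermitian {n : ℕ} {B : Matrix (Fin n) (Fin n) ℂ}
    (hB : B.IsHermitian) (x y : EuclideanSpace ℂ (Fin n)) :
    inner ℂ (toEuclideanCLM (𝕜 := ℂ) B x) y = inner ℂ x (toEuclideanCLM (𝕜 := ℂ) B y) := by
  have h : star (toEuclideanCLM (𝕜 := ℂ) B) = toEuclideanCLM (𝕜 := ℂ) B := by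
    rw [← map_star, star_eq_conjTranspose, hB.eq]
  rw [← ContinuousLinearMap.adjoint_inner_right, ← ContinuousLinearMap.star_eq_adjoint, h]

/-! ### Growth of solutions of the ordinary differential equations -/

section Growth

variable {V : Type*} [NormedAddCommGroup V] [InnerProductSpace ℂ V]

theorem hasDerivWithinAt_norm_sq_of_skew {S K : V →L[ℂ] V}
    (hS : ∀ x y, inner ℂ (S x) y = inner ℂ x (S y))
    (hK : ∀ x y, inner ℂ (K x) y = -inner ℂ x (K y)) {u : ℝ → V} {s : Set ℝ} {t : ℝ}
    (hu : HasDerivWithinAt u (S (u t) + K (u t)) s t) :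
    HasDerivWithinAt (fun t => ‖u t‖ ^ 2) (2 * (inner ℂ (u t) (S (u t))).re) s t := by
  have h1 := Complex.reCLM.hasFDerivAt.comp_hasDerivWithinAt t (hu.inner ℂ hu)
  have h2 : (fun t => ‖u t‖ ^ 2) = Complex.reCLM ∘ fun t => inner ℂ (u t) (u t) := by
    funext t
    simp [inner_self_eq_norm_sq_to_K, ← Complex.ofReal_pow]
  rw [h2]
  refine h1.congr_deriv ?_
  rw [inner_add_left, inner_add_right, hS, hK]
  simp only [Complex.reCLM_apply, Complex.add_re, Complex.neg_re]
  ring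

theorem norm_le_exp_mul_norm_zero {S K : ℝ → V →L[ℂ] V}
    (hS : ∀ t x y, inner ℂ (S t x) y = inner ℂ x (S t y))
    (hK : ∀ t x y, inner ℂ (K t x) y = -inner ℂ x (K t y)) {u : ℝ → V} {T : ℝ} (hT : 0 ≤ T)
    (hu : ∀ t ∈ Set.Icc 0 T, HasDerivWithinAt u (S t (u t) + K t (u t)) (Set.Icc 0 T) t) {c : ℝ}
    (hc : ∀ t ∈ Set.Ioo 0 T, ∀ x, (inner ℂ x (S t x)).re ≤ c * ‖x‖ ^ 2) :
    ‖u T‖ ≤ Real.exp (c * T) * ‖u 0‖ := by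
  have hexp : ∀ t, HasDerivAt (fun t => Real.exp (-(2 * c) * t))
      (Real.exp (-(2 * c) * t) * (-(2 * c))) t := fun t => by
    simpa using ((hasDerivAt_id t).const_mul (-(2 * c))).exp
  have hd : ∀ t ∈ Set.Icc 0 T, HasDerivWithinAt (fun t => Real.exp (-(2 * c) * t) * ‖u t‖ ^ 2) _
      (Set.Icc 0 T) t := fun t ht =>
    (hexp t).hasDerivWithinAt.mul (hasDerivWithinAt_norm_sq_of_skew (hS t) (hK t) (hu t ht))
  have hanti : AntitoneOn (fun t => Real.exp (-(2 * c) * t) * ‖u t‖ ^ 2) (Set.Icc 0 T) := by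
    refine antitoneOn_of_hasDerivWithinAt_nonpos (convex_Icc 0 T)
      (fun t ht => (hd t ht).continuousWithinAt)
      (fun t ht => (hd t (interior_subset ht)).mono interior_subset) fun t ht => ?_
    rw [interior_Icc] at ht
    have h1 := hc t ht (u t)
    have h2 := Real.exp_pos (-(2 * c) * t)
    nlinarith
  have h := hanti (Set.left_mem_Icc.2 hT) (Set.right_mem_Icc.2 hT) hT
  simp only [mul_zero, Real.exp_zero, one_mul] at h
  refine le_of_sq_le_sq ?_ (by positivity)
  calc ‖u T‖ ^ 2 = Real.exp (c * T) ^ 2 * (Real.exp (-(2 * c) * T) * ‖u T‖ ^ 2) := by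
        rw [← mul_assoc, ← Real.exp_nat_mul, ← Real.exp_add]
        norm_num
        ring_nf
        simp
    _ ≤ Real.exp (c * T) ^ 2 * ‖u 0‖ ^ 2 := by gcongr
    _ = _ := by ring

theorem norm_zero_le_exp_mul_norm {S K : ℝ → V →L[ℂ] V}
    (hS : ∀ t x y, inner ℂ (S t x) y = inner ℂ x (S t y))
    (hK : ∀ t x y, inner ℂ (K t x) y = -inner ℂ x (K t y)) {u : ℝ → V} {T : ℝ} (hT : 0 ≤ T)
    (hu : ∀ t ∈ Set.Icc 0 T, HasDerivWithinAt u (S t (u t) + K t (u t)) (Set.Icc 0 T) t) {c : ℝ}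
    (hc : ∀ t ∈ Set.Ioo 0 T, ∀ x, -(c * ‖x‖ ^ 2) ≤ (inner ℂ x (S t x)).re) :
    ‖u 0‖ ≤ Real.exp (c * T) * ‖u T‖ := by
  -- the time-reversed function solves the equation with `-S(T - t)` and `-K(T - t)`
  have hmem : Set.MapsTo (fun t => T - t) (Set.Icc 0 T) (Set.Icc 0 T) := fun t ht =>
    ⟨by linarith [ht.2], by linarith [ht.1]⟩
  have h := norm_le_exp_mul_norm_zero (S := fun t => -S (T - t)) (K := fun t => -K (T - t))
    (u := fun t => u (T - t)) (T := T) (c := c) (fun t x y => by simp [hS])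
    (fun t x y => by simp [hK]) hT (fun t ht => ?_) (fun t ht x => ?_)
  · simpa using h
  · have h1 := (hu (T - t) (hmem ht)).scomp t
      ((hasDerivAt_id t).const_sub T).hasDerivWithinAt hmem
    refine h1.congr_deriv ?_
    simp
  · have := hc (T - t) ⟨by linarith [ht.2], by linarith [ht.1]⟩ x
    simp only [_root_.neg_apply, inner_neg_right, Complex.neg_re]
    linarith

end Growth

theorem inner_I_smul_H2 {n : ℕ} (A : Matrix (Fin n) (Fin n) ℂ) (x y : EuclideanSpace ℂ (Fin n)) :
    inner ℂ ((Complex.I • toEuclideanCLM (𝕜 := ℂ) (H2 A)) x) y =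
      -inner ℂ x ((Complex.I • toEuclideanCLM (𝕜 := ℂ) (H2 A)) y) := by
  simp only [_root_.smul_apply, inner_smul_left, inner_smul_right,
    inner_toEuclideanCLM_of_isHermitian (isHermitian_H2 A), Complex.conj_I]
  ring

theorem IsODESolution.hasDerivWithinAt {n : ℕ} {A : ℝ → Matrix (Fin n) (Fin n) ℂ} {T : ℝ}
    {u₀ : EuclideanSpace ℂ (Fin n)} {u : ℝ → EuclideanSpace ℂ (Fin n)}
    (hu : IsODESolution A T u₀ u) {t : ℝ} (ht : t ∈ Set.Icc 0 T) :
    HasDerivWithinAt u (toEuclideanCLM (𝕜 := ℂ) (H1 (A t)) (u t)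
      + (Complex.I • toEuclideanCLM (𝕜 := ℂ) (H2 (A t))) (u t)) (Set.Icc 0 T) t := by
  refine (hu.2 t ht).congr_deriv ?_
  rw [← _root_.add_apply, ← map_smul, ← map_add, H1_add_I_smul_H2]
  rfl

/-- The block of the coefficient vector `w` that belongs to the frequency with index `l`. -/
def block {n N : ℕ} (w : Fin N × Fin n → ℂ) (l : Fin N) : EuclideanSpace ℂ (Fin n) :=
  WithLp.toLp 2 fun j => w (l, j)

theorem Hd_mulVec_apply {n N : ℕ} (L : ℝ) (A : Matrix (Fin n) (Fin n) ℂ) (w : Fin N × Fin n → ℂ)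
    (l : Fin N) (j : Fin n) :
    (Hd L N A *ᵥ w) (l, j) =
      (freq L N l : ℂ) * (H1 A *ᵥ fun k => w (l, k)) j - (H2 A *ᵥ fun k => w (l, k)) j := by
  simp only [Hd, mulVec, dotProduct, Fintype.sum_prod_type, Dp, Finset.mul_sum]
  rw [Finset.sum_eq_single l]
  · simp [sub_mul, mul_assoc]
  · intro k _ hk
    simp [hk.symm]
  · simp

theorem IsDiscreteSolution.hasDerivWithinAt_block {n N : ℕ} {A : ℝ → Matrix (Fin n) (Fin n) ℂ}
    {T L : ℝ} {u₀ : EuclideanSpace ℂ (Fin n)} {w : ℝ → Fin N × Fin n → ℂ}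
    (hw : IsDiscreteSolution A T L N u₀ w) (l : Fin N) {t : ℝ} (ht : t ∈ Set.Icc 0 T) :
    HasDerivWithinAt (fun s => block (w s) l)
      (-((Complex.I * freq L N l) • toEuclideanCLM (𝕜 := ℂ) (H1 (A t)) (block (w t) l))
        + (Complex.I • toEuclideanCLM (𝕜 := ℂ) (H2 (A t))) (block (w t) l)) (Set.Icc 0 T) t := by
  have h1 : HasDerivWithinAt (fun s j => w s (l, j))
      (fun j => ((-Complex.I) • (Hd L N (A t) *ᵥ w t)) (l, j)) (Set.Icc 0 T) t :=
    hasDerivWithinAt_pi.2 fun j => hasDerivWithinAt_pi.1 (hw.2 t ht) (l, j)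
  have h2 := (PiLp.continuousLinearEquiv 2 ℝ (fun _ : Fin n => ℂ)).symm.toContinuousLinearMap
    |>.hasFDerivAt.comp_hasDerivWithinAt t h1
  refine h2.congr_deriv ?_
  ext j
  have e : ∀ B : Matrix (Fin n) (Fin n) ℂ,
      toEuclideanCLM (𝕜 := ℂ) B (block (w t) l) j = (B *ᵥ fun k => w t (l, k)) j := fun _ => rfl
  simp only [PiLp.add_apply, PiLp.neg_apply, PiLp.smul_apply, _root_.smul_apply, e, smul_eq_mul]
  change -Complex.I * (Hd L N (A t) *ᵥ w t) (l, j) = _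
  rw [Hd_mulVec_apply]
  ring

theorem IsDiscreteSolution.norm_block_le {n N : ℕ} {A : ℝ → Matrix (Fin n) (Fin n) ℂ}
    {T L : ℝ} (hT : 0 ≤ T) {u₀ : EuclideanSpace ℂ (Fin n)} {w : ℝ → Fin N × Fin n → ℂ}
    (hw : IsDiscreteSolution A T L N u₀ w) (l : Fin N) :
    ‖block (w T) l‖ ≤ ‖block (w 0) l‖ := by
  have h := norm_le_exp_mul_norm_zero (S := fun _ => 0)
    (K := fun t => -((Complex.I * freq L N l) • toEuclideanCLM (𝕜 := ℂ) (H1 (A t)))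
      + Complex.I • toEuclideanCLM (𝕜 := ℂ) (H2 (A t)))
    (u := fun t => block (w t) l) (c := 0) (by simp) (fun t x y => ?_) hT (fun t ht => ?_) (by simp)
  · simpa using h
  · rw [_root_.add_apply, _root_.add_apply, inner_add_left, inner_add_right, inner_I_smul_H2]
    simp only [_root_.neg_apply, _root_.smul_apply, inner_neg_left, inner_neg_right,
      inner_smul_left, inner_smul_right, inner_toEuclideanCLM_of_isHermitian (isHermitian_H1 _),
      map_mul, Complex.conj_I, Complex.conj_ofReal]
    ring
  · refine (hw.hasDerivWithinAt_block l ht).congr_deriv ?_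
    simp

/-! ### Orthogonality of the Fourier basis -/

section Fourier

variable {L : ℝ} {N : ℕ}

theorem hasDerivAt_basisFun (L : ℝ) (N : ℕ) (l : Fin N) (p : ℝ) :
    HasDerivAt (basisFun L N l) (Complex.I * freq L N l * basisFun L N l p) p := by
  have h1 : HasDerivAt (fun p : ℝ => freq L N l * (p + π * L)) (freq L N l) p := by
    simpa using ((hasDerivAt_id p).add_const (π * L)).const_mul (freq L N l)
  have h2 := (h1.ofReal_comp.const_mul Complex.I).cexp
  refine h2.congr_deriv ?_
  rw [basisFun]
  ring

theorem continuous_basisFun (L : ℝ) (N : ℕ) (l : Fin N) : Continuous (basisFun L N l) :=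
  continuous_iff_continuousAt.2 fun p => (hasDerivAt_basisFun L N l p).continuousAt

theorem norm_basisFun (l : Fin N) (p : ℝ) : ‖basisFun L N l p‖ = 1 := by
  rw [basisFun, mul_comm, Complex.norm_exp_ofReal_mul_I]

theorem basisFun_periodic (hL : L ≠ 0) (hN : Even N) (l : Fin N) :
    Function.Periodic (basisFun L N l) (2 * π * L) := by
  obtain ⟨K, rfl⟩ := hN
  intro p
  have h : Complex.I * ((freq L (K + K) l * (p + 2 * π * L + π * L) : ℝ) : ℂ) =
      Complex.I * ((freq L (K + K) l * (p + π * L) : ℝ) : ℂ)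
        + (((l : ℤ) - K : ℤ) : ℂ) * (2 * π * Complex.I) := by
    have hL' : (L : ℂ) ≠ 0 := by exact_mod_cast hL
    simp only [freq]
    push_cast
    field_simp
    ring
  rw [basisFun, basisFun, h, Complex.exp_add, Complex.exp_int_mul_two_pi_mul_I, mul_one]

theorem integral_conj_basisFun_mul (hL : L ≠ 0) (hN : Even N) (m : ℕ) (x : ℝ) (k l : Fin N) :
    ∫ p in x..(x + m * (2 * π * L)), starRingEnd ℂ (basisFun L N k p) * basisFun L N l p =
      if k = l then ((m * (2 * π * L) : ℝ) : ℂ) else 0 := by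
  split_ifs with hkl
  · subst hkl
    simp [Complex.conj_mul', norm_basisFun]
  · set f : ℝ → ℂ := fun p => starRingEnd ℂ (basisFun L N k p) * basisFun L N l p with hf
    have hper : Function.Periodic f (2 * π * L) := fun p => by
      simp only [hf, basisFun_periodic hL hN _ p]
    have hcont : Continuous f :=
      (Complex.continuous_conj.comp (continuous_basisFun L N k)).mul (continuous_basisFun L N l)
    have hd : ∀ p, HasDerivAt f (Complex.I * (freq L N l - freq L N k) * f p) p := by
      intro p
      have h1 : HasDerivAt (fun p => starRingEnd ℂ (basisFun L N k p)) _ p :=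
        (hasDerivAt_basisFun L N k p).star
      refine (h1.mul (hasDerivAt_basisFun L N l p)).congr_deriv ?_
      simp only [hf, star_mul', Complex.star_def, Complex.conj_I, Complex.conj_ofReal]
      ring
    have h := intervalIntegral.integral_eq_sub_of_hasDerivAt (a := x) (b := x + m * (2 * π * L))
      (fun p _ => hd p) ((hcont.const_mul _).intervalIntegrable _ _)
    rw [intervalIntegral.integral_const_mul, hper.nat_mul m x, sub_self] at h
    refine (mul_eq_zero.1 h).resolve_left (mul_ne_zero Complex.I_ne_zero ?_)
    rw [sub_ne_zero]
    intro h'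
    apply hkl
    have h2 : freq L N l = freq L N k := by exact_mod_cast h'
    rw [freq, freq, div_left_inj' hL, sub_left_inj] at h2
    exact Fin.ext (by exact_mod_cast h2.symm)

variable {V : Type*} [NormedAddCommGroup V] [InnerProductSpace ℂ V]

theorem integral_norm_sq_sum_basisFun (hL : L ≠ 0) (hN : Even N) (m : ℕ) (x : ℝ) (v : Fin N → V) :
    ∫ p in x..(x + m * (2 * π * L)), ‖∑ l, basisFun L N l p • v l‖ ^ 2 =
      m * (2 * π * L) * ∑ l, ‖v l‖ ^ 2 := by
  have h := integral_inner_sum_smul (continuous_basisFun L N) v v x (x + m * (2 * π * L))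
  simp only [integral_conj_basisFun_mul hL hN, mul_ite, mul_zero, Finset.sum_ite_eq,
    Finset.mem_univ, if_true, inner_self_eq_norm_sq_to_K, ← Finset.sum_mul] at h
  have h2 : (∫ p in x..(x + m * (2 * π * L)),
      (((‖∑ l, basisFun L N l p • v l‖ : ℝ) : ℂ)) ^ 2) =
      ((∫ p in x..(x + m * (2 * π * L)), ‖∑ l, basisFun L N l p • v l‖ ^ 2 : ℝ) : ℂ) := by
    rw [← intervalIntegral.integral_ofReal]
    simp
  rw [← Complex.ofReal_inj, ← h2]
  refine h.trans ?_
  push_cast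
  simp only [mul_comm, Complex.coe_algebraMap]

/-- One step of the grid in the frequency `μ_l`, the factor `exp(i μ_l Δp)`. -/
noncomputable def gridRoot (L : ℝ) (N : ℕ) (l : Fin N) : ℂ :=
  Complex.exp (Complex.I * ((freq L N l * meshSize L N : ℝ) : ℂ))

theorem basisFun_grid (l : Fin N) (j : ℕ) :
    basisFun L N l (-(π * L) + j * meshSize L N) = gridRoot L N l ^ j := by
  rw [basisFun, gridRoot, ← Complex.exp_nat_mul]
  congr 1
  push_cast
  ring

theorem sum_conj_gridRoot_mul (hL : L ≠ 0) (k l : Fin N) :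
    ∑ j ∈ Finset.range N, starRingEnd ℂ (gridRoot L N k ^ j) * gridRoot L N l ^ j =
      if k = l then (N : ℂ) else 0 := by
  have hN : (N : ℂ) ≠ 0 := by
    have : 0 < N := l.pos
    exact_mod_cast this.ne'
  have hL' : (L : ℂ) ≠ 0 := by exact_mod_cast hL
  set r : ℂ := starRingEnd ℂ (gridRoot L N k) * gridRoot L N l with hr
  have hrexp : r = Complex.exp ((((l : ℤ) - (k : ℤ) : ℤ) : ℂ) / N * (2 * π * Complex.I)) := by
    rw [hr, gridRoot, gridRoot, ← Complex.exp_conj, ← Complex.exp_add]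
    congr 1
    simp only [map_mul, Complex.conj_I, Complex.conj_ofReal, freq, meshSize]
    push_cast
    field_simp
    ring
  simp only [map_pow, ← mul_pow, ← hr]
  split_ifs with hkl
  · subst hkl
    rw [hrexp]
    simp
  · have hrN : r ^ N = 1 := by
      rw [hrexp, ← Complex.exp_nat_mul, ← mul_assoc, mul_div_cancel₀ _ hN,
        Complex.exp_int_mul_two_pi_mul_I]
    have hr1 : r ≠ 1 := by
      rw [hrexp, Ne, Complex.exp_eq_one_iff]
      rintro ⟨z, hz⟩
      have h2 : (2 * π * Complex.I : ℂ) ≠ 0 := by simp [Real.pi_ne_zero]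
      have h3 := mul_right_cancel₀ h2 hz
      rw [div_eq_iff hN] at h3
      have h4 : (l : ℤ) - (k : ℤ) = z * N := by exact_mod_cast h3
      have h5 : ((l : ℤ) - (k : ℤ)) = 0 := by
        refine Int.eq_zero_of_abs_lt_dvd (m := (N : ℤ)) ⟨z, by rw [h4, mul_comm]⟩ ?_
        have := l.isLt
        have := k.isLt
        rw [abs_lt]
        omega
      exact hkl (Fin.ext (by omega))
    rw [geom_sum_eq hr1, hrN, sub_self, zero_div]

theorem sum_norm_sq_sum_gridRoot (hL : L ≠ 0) (v : Fin N → V) :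
    ∑ j ∈ Finset.range N, ‖∑ l, gridRoot L N l ^ j • v l‖ ^ 2 = N * ∑ l, ‖v l‖ ^ 2 := by
  rw [← Complex.ofReal_inj]
  have h : ∀ x : V, ((‖x‖ ^ 2 : ℝ) : ℂ) = inner ℂ x x := fun x => by
    rw [inner_self_eq_norm_sq_to_K]; simp
  rw [Complex.ofReal_sum, Complex.ofReal_mul, Complex.ofReal_sum]
  simp only [h, inner_sum_smul_sum_smul]
  rw [Finset.sum_comm, Finset.mul_sum]
  refine Finset.sum_congr rfl fun k _ => ?_
  rw [Finset.sum_comm]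
  simp only [← Finset.mul_sum, sum_conj_gridRoot_mul hL, mul_ite, mul_zero, Finset.sum_ite_eq,
    Finset.mem_univ, if_true]
  simp [mul_comm]

end Fourier

/-! ### The interpolant of the initial profile -/

/-- Discrete Fourier coefficients of the grid values of `e^{-|p|}`. -/
noncomputable def profileCoeff (L : ℝ) (N : ℕ) : Fin N → ℂ :=
  (Phi L N)⁻¹ *ᵥ fun j => (Real.exp (-|gridPoint L N j|) : ℂ)

/-- Trigonometric interpolant of `e^{-|p|}` on the grid. -/
noncomputable def profileInterp (L : ℝ) (N : ℕ) (p : ℝ) : ℂ :=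
  ∑ l, basisFun L N l p • profileCoeff L N l

theorem Phi_apply (L : ℝ) (N : ℕ) (j l : Fin N) : Phi L N j l = gridRoot L N l ^ (j : ℕ) := by
  rw [Phi, of_apply, gridPoint, basisFun_grid]

theorem conjTranspose_Phi_mul_Phi {L : ℝ} (hL : L ≠ 0) (N : ℕ) :
    (Phi L N)ᴴ * Phi L N = (N : ℂ) • 1 := by
  ext k l
  have h := sum_conj_gridRoot_mul (N := N) hL k l
  rw [Finset.sum_range] at h
  simp only [mul_apply, conjTranspose_apply, Phi_apply, Matrix.smul_apply, one_apply, smul_eq_mul,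
    mul_ite, mul_one, mul_zero]
  exact h

theorem isUnit_det_Phi {L : ℝ} (hL : L ≠ 0) (N : ℕ) : IsUnit (Phi L N).det := by
  rcases Nat.eq_zero_or_pos N with rfl | hN
  · simp
  · have hN' : (N : ℂ) ≠ 0 := by exact_mod_cast hN.ne'
    have h : ((N : ℂ)⁻¹ • (Phi L N)ᴴ) * Phi L N = 1 := by
      rw [Matrix.smul_mul, conjTranspose_Phi_mul_Phi hL, smul_smul, inv_mul_cancel₀ hN', one_smul]
    exact isUnit_det_of_left_inverse h

theorem continuous_profileInterp (L : ℝ) (N : ℕ) : Continuous (profileInterp L N) :=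
  continuous_finsetSum _ fun l _ => (continuous_basisFun L N l).smul continuous_const

theorem mul_meshSize (L : ℝ) {N : ℕ} (hN : 0 < N) : N * meshSize L N = 2 * π * L := by
  have : (N : ℝ) ≠ 0 := by exact_mod_cast hN.ne'
  rw [meshSize]
  field_simp

/-- The interpolant agrees with `e^{-|p|}` at all grid points, also at the right endpoint `πL`, by
periodicity. -/
theorem profileInterp_grid {L : ℝ} (hL : 0 < L) {N : ℕ} (hN0 : 0 < N) (hN : Even N) {j : ℕ}
    (hj : j ≤ N) :
    profileInterp L N (-(π * L) + j * meshSize L N) =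
      (Real.exp (-|-(π * L) + j * meshSize L N|) : ℂ) := by
  have key : ∀ j < N, profileInterp L N (-(π * L) + j * meshSize L N) =
      (Real.exp (-|-(π * L) + j * meshSize L N|) : ℂ) := by
    intro j hj
    have h : Phi L N *ᵥ profileCoeff L N = fun j => (Real.exp (-|gridPoint L N j|) : ℂ) := by
      rw [profileCoeff, mulVec_mulVec, mul_nonsing_inv _ (isUnit_det_Phi hL.ne' N), one_mulVec]
    exact congrFun h ⟨j, hj⟩
  rcases hj.lt_or_eq with h | rfl
  · exact key j h
  · have h1 := key 0 hN0
    have h2 : profileInterp L j (-(π * L) + 2 * π * L) = profileInterp L j (-(π * L)) := by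
      simp only [profileInterp, basisFun_periodic hL.ne' hN _ _]
    have h3 : -(π * L) + 2 * π * L = π * L := by ring
    rw [mul_meshSize L hN0, h2]
    simp only [Nat.cast_zero, zero_mul, add_zero] at h1
    rw [h1, h3, abs_neg]

theorem exp_sub_exp_sub_mem_Icc {s h : ℝ} (hs : s ≤ 0) (hh : 0 ≤ h) :
    Real.exp s - Real.exp (s - h) ∈ Set.Icc 0 h := by
  refine ⟨sub_nonneg.2 (Real.exp_le_exp.2 (by linarith)), ?_⟩
  have h1 : Real.exp (s - h) = Real.exp s * Real.exp (-h) := by rw [← Real.exp_add]; rfl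
  have h2 := Real.add_one_le_exp (-h)
  have h3 : Real.exp s ≤ 1 := Real.exp_le_one_iff.2 hs
  have h4 := Real.exp_pos s
  have h5 : Real.exp (-h) ≤ 1 := Real.exp_le_one_iff.2 (by linarith)
  rw [h1]
  nlinarith

/-- A sum over the grid, split at the grid point `0`, which has index `K = N / 2`. -/
theorem sum_grid_split {α : Type*} [AddCommMonoid α] (f : ℝ → ℝ → α) {L : ℝ} {K : ℕ} (hK : 0 < K) :
    ∑ j ∈ Finset.range (K + K), f (-(π * L) + j * meshSize L (K + K))
        (-(π * L) + (j + 1 : ℕ) * meshSize L (K + K)) =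
      ∑ k ∈ Finset.range K, f (-((k + 1 : ℕ) * meshSize L (K + K))) (-(k * meshSize L (K + K)))
        + ∑ k ∈ Finset.range K, f (k * meshSize L (K + K))
          ((k + 1 : ℕ) * meshSize L (K + K)) := by
  have h := mul_meshSize L (N := K + K) (by omega)
  set d := meshSize L (K + K)
  push_cast at h
  have hπ : π * L = K * d := by linarith
  rw [Finset.sum_range_add, ← Finset.sum_range_reflect]
  congr 1
  · refine Finset.sum_congr rfl fun k hk => ?_
    have hk' : k + 1 ≤ K := Finset.mem_range.1 hk
    have e1 : ((K - 1 - k : ℕ) : ℝ) = K - 1 - k := by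
      rw [Nat.sub_sub, Nat.cast_sub (by omega)]
      push_cast
      ring
    rw [hπ]
    congr 1
    · rw [e1]
      push_cast
      ring
    · push_cast
      rw [e1]
      ring
  · refine Finset.sum_congr rfl fun k _ => ?_
    rw [hπ]
    congr 1 <;> (push_cast; ring)

theorem sum_sq_le_of_telescoping {f : ℕ → ℝ} {h : ℝ} (hh : 0 ≤ h) (K : ℕ)
    (hf : ∀ k < K, f k - f (k + 1) ∈ Set.Icc 0 h) (h0 : f 0 ≤ 1) (hK : 0 ≤ f K) :
    ∑ k ∈ Finset.range K, (f k - f (k + 1)) ^ 2 ≤ h := by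
  calc ∑ k ∈ Finset.range K, (f k - f (k + 1)) ^ 2
      ≤ ∑ k ∈ Finset.range K, h * (f k - f (k + 1)) := by
        refine Finset.sum_le_sum fun k hk => ?_
        have h1 := hf k (Finset.mem_range.1 hk)
        rw [sq]
        exact mul_le_mul_of_nonneg_right h1.2 h1.1
    _ = h * (f 0 - f K) := by rw [← Finset.mul_sum, Finset.sum_range_sub']
    _ ≤ h := by nlinarith

/-- The increments of `e^{-|p|}` along the grid are bounded by `Δp` and their absolute values sum to
at most `2`, whence the sum of their squares is at most `2Δp`. -/
theorem sum_sq_increment_le {L : ℝ} (hL : 0 < L) {N : ℕ} (hN0 : 0 < N) (hN : Even N) :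
    ∑ j ∈ Finset.range N, (Real.exp (-|-(π * L) + (j + 1 : ℕ) * meshSize L N|)
      - Real.exp (-|-(π * L) + j * meshSize L N|)) ^ 2 ≤ 2 * meshSize L N := by
  obtain ⟨K, rfl⟩ := hN
  have hd : 0 ≤ meshSize L (K + K) := by unfold meshSize; positivity
  rw [sum_grid_split (fun x y => (Real.exp (-|y|) - Real.exp (-|x|)) ^ 2) (by omega)]
  set d := meshSize L (K + K)
  have h := sum_sq_le_of_telescoping (f := fun k => Real.exp (-(k * d))) hd K (fun k _ => ?_)
    (by simp) (Real.exp_pos _).le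
  · have e : ∀ k : ℕ, |(k : ℝ) * d| = k * d := fun k => abs_of_nonneg (by positivity)
    simp only [abs_neg, e]
    have h2 : ∀ k : ℕ, (Real.exp (-((k + 1 : ℕ) * d)) - Real.exp (-(k * d))) ^ 2 =
      (Real.exp (-(k * d)) - Real.exp (-((k + 1 : ℕ) * d))) ^ 2 := fun k => by ring
    simp only [h2]
    linarith
  · have h1 := exp_sub_exp_sub_mem_Icc (s := -(k * d)) (h := d)
      (by have : 0 ≤ (k : ℝ) * d := by positivity
          linarith) hd
    convert h1 using 3
    push_cast
    ring

theorem meshSize_mul_sum_sq_le {L : ℝ} (hL : 0 < L) {N : ℕ} (hN0 : 0 < N) (hN : Even N) :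
    meshSize L N * ∑ j ∈ Finset.range N, Real.exp (-|-(π * L) + j * meshSize L N|) ^ 2 ≤
      1 + meshSize L N := by
  obtain ⟨K, rfl⟩ := hN
  have hd : 0 < meshSize L (K + K) := by
    have : (0 : ℝ) < (K + K : ℕ) := by exact_mod_cast hN0
    unfold meshSize
    positivity
  rw [sum_grid_split (fun x _ => Real.exp (-|x|) ^ 2) (by omega)]
  set d := meshSize L (K + K)
  have e : ∀ k : ℕ, |(k : ℝ) * d| = k * d := fun k => abs_of_nonneg (by positivity)
  simp only [abs_neg, e]
  have h1 : ∀ k : ℕ, 2 * d * Real.exp (-((k + 1 : ℕ) * d)) ^ 2 ≤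
      Real.exp (-(k * d)) ^ 2 - Real.exp (-((k + 1 : ℕ) * d)) ^ 2 := by
    intro k
    have h2 : Real.exp (-(k * d)) = Real.exp (-((k + 1 : ℕ) * d)) * Real.exp d := by
      rw [← Real.exp_add]
      congr 1
      push_cast
      ring
    have h3 : 1 + 2 * d ≤ Real.exp d ^ 2 := by nlinarith [Real.add_one_le_exp d]
    rw [h2]
    nlinarith [sq_nonneg (Real.exp (-((k + 1 : ℕ) * d)))]
  have h2 : 2 * d * ∑ k ∈ Finset.range K, Real.exp (-((k + 1 : ℕ) * d)) ^ 2 ≤ 1 := by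
    rw [Finset.mul_sum]
    refine (Finset.sum_le_sum fun k _ => h1 k).trans ?_
    rw [Finset.sum_range_sub' (fun k : ℕ => Real.exp (-(k * d)) ^ 2)]
    simp only [Nat.cast_zero, zero_mul, neg_zero, Real.exp_zero, one_pow]
    linarith [sq_nonneg (Real.exp (-(K * d)))]
  have h3 : ∑ k ∈ Finset.range K, Real.exp (-(k * d)) ^ 2 ≤
      ∑ k ∈ Finset.range K, Real.exp (-((k + 1 : ℕ) * d)) ^ 2 + 1 := by
    have h4 := Finset.sum_range_succ (fun k : ℕ => Real.exp (-(k * d)) ^ 2) K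
    rw [Finset.sum_range_succ'] at h4
    simp only [Nat.cast_zero, zero_mul, neg_zero, Real.exp_zero, one_pow] at h4
    linarith [sq_nonneg (Real.exp (-(K * d)))]
  nlinarith

theorem gridRoot_slope {L : ℝ} (hL : 0 < L) {N : ℕ} (l : Fin N) :
    2 / π * (|freq L N l| * meshSize L N) ≤ ‖gridRoot L N l - 1‖ := by
  have hN : (0 : ℝ) < N := by exact_mod_cast l.pos
  have hd : 0 ≤ meshSize L N := by unfold meshSize; positivity
  have hl : (l : ℝ) ≤ N := by exact_mod_cast l.isLt.le
  have habs : |freq L N l * meshSize L N / 2| ≤ π / 2 := by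
    have e : freq L N l * meshSize L N / 2 = π / 2 * ((2 * l - N) / N) := by
      unfold freq meshSize
      field_simp
    have h1 : |(2 * (l : ℝ) - N) / N| ≤ 1 := by
      rw [abs_div, abs_of_pos hN, div_le_one hN, abs_le]
      constructor <;> linarith [Nat.cast_nonneg (α := ℝ) (l : ℕ)]
    rw [e, abs_mul, abs_of_pos (by positivity : 0 < π / 2)]
    exact mul_le_of_le_one_right (by positivity) h1
  have h2 := Real.mul_abs_le_abs_sin habs
  rw [gridRoot, Complex.norm_exp_I_mul_ofReal_sub_one, Real.norm_eq_abs, abs_mul, abs_two]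
  rw [abs_div, abs_mul, abs_two, abs_of_nonneg hd] at h2
  linarith

theorem sum_norm_sq_profileCoeff {L : ℝ} (hL : 0 < L) {N : ℕ} (hN0 : 0 < N) (hN : Even N) :
    2 * π * L * ∑ l, ‖profileCoeff L N l‖ ^ 2 = meshSize L N *
      ∑ j ∈ Finset.range N, Real.exp (-|-(π * L) + j * meshSize L N|) ^ 2 := by
  have h := sum_norm_sq_sum_gridRoot hL.ne' (profileCoeff L N)
  rw [← mul_meshSize L hN0, mul_comm (N : ℝ), mul_assoc, ← h]
  congr 1
  refine Finset.sum_congr rfl fun j hj => ?_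
  have h1 := profileInterp_grid hL hN0 hN (Finset.mem_range.1 hj).le
  simp only [profileInterp, basisFun_grid] at h1
  rw [h1, Complex.norm_real, Real.norm_eq_abs, sq_abs]

/-- The inverse inequality for trigonometric polynomials, combined with the bound on the increments
of the profile: the derivative of the interpolant is bounded in `L²` over a period. -/
theorem sum_freq_sq_profileCoeff_le {L : ℝ} (hL : 0 < L) {N : ℕ} (hN0 : 0 < N) (hN : Even N) :
    2 * π * L * ∑ l, ‖Complex.I * freq L N l * profileCoeff L N l‖ ^ 2 ≤ π ^ 2 / 2 := by
  have hd : 0 < meshSize L N := by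
    have : (0 : ℝ) < N := by exact_mod_cast hN0
    unfold meshSize
    positivity
  have h := sum_norm_sq_sum_gridRoot hL.ne'
    (fun l => (gridRoot L N l - 1) * profileCoeff L N l)
  have h1 : ∀ j ∈ Finset.range N,
      ‖∑ l, gridRoot L N l ^ j • ((gridRoot L N l - 1) * profileCoeff L N l)‖ ^ 2 =
        (Real.exp (-|-(π * L) + (j + 1 : ℕ) * meshSize L N|)
          - Real.exp (-|-(π * L) + j * meshSize L N|)) ^ 2 := by
    intro j hj
    have hj' := Finset.mem_range.1 hj
    have e1 := profileInterp_grid hL hN0 hN hj'.le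
    have e2 := profileInterp_grid hL hN0 hN (Nat.succ_le_iff.2 hj')
    simp only [profileInterp, basisFun_grid] at e1 e2
    have e3 : ∑ l, gridRoot L N l ^ j • ((gridRoot L N l - 1) * profileCoeff L N l) =
        ∑ l, gridRoot L N l ^ (j + 1) • profileCoeff L N l
          - ∑ l, gridRoot L N l ^ j • profileCoeff L N l := by
      rw [← Finset.sum_sub_distrib]
      refine Finset.sum_congr rfl fun l _ => ?_
      simp only [smul_eq_mul]
      ring
    rw [e3, e1, e2, ← Complex.ofReal_sub, Complex.norm_real, Real.norm_eq_abs, sq_abs]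
  rw [Finset.sum_congr rfl h1] at h
  have h2 := sum_sq_increment_le hL hN0 hN
  rw [h] at h2
  have h3 : ∀ l, (2 / π * meshSize L N) ^ 2 * ‖Complex.I * freq L N l * profileCoeff L N l‖ ^ 2 ≤
      ‖(gridRoot L N l - 1) * profileCoeff L N l‖ ^ 2 := by
    intro l
    rw [← mul_pow]
    refine pow_le_pow_left₀ (by positivity) ?_ 2
    rw [norm_mul, norm_mul, norm_mul, Complex.norm_I, one_mul, Complex.norm_real, Real.norm_eq_abs]
    calc _ = 2 / π * (|freq L N l| * meshSize L N) * ‖profileCoeff L N l‖ := by ring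
      _ ≤ _ := mul_le_mul_of_nonneg_right (gridRoot_slope hL l) (norm_nonneg _)
  have h4 := Finset.sum_le_sum fun l (_ : l ∈ Finset.univ) => h3 l
  rw [← Finset.mul_sum] at h4
  set X := ∑ l, ‖Complex.I * freq L N l * profileCoeff L N l‖ ^ 2
  rw [← mul_meshSize L hN0]
  have h5 : N * ((2 / π * meshSize L N) ^ 2 * X) ≤ 2 * meshSize L N :=
    (mul_le_mul_of_nonneg_left h4 (Nat.cast_nonneg N)).trans h2
  have h6 : N * meshSize L N * X =
      π ^ 2 / (4 * meshSize L N) * (N * ((2 / π * meshSize L N) ^ 2 * X)) := by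
    field_simp
    ring
  rw [h6]
  calc _ ≤ π ^ 2 / (4 * meshSize L N) * (2 * meshSize L N) := by gcongr
    _ = _ := by field_simp; ring

theorem hasDerivAt_profileInterp (L : ℝ) (N : ℕ) (p : ℝ) :
    HasDerivAt (profileInterp L N)
      (∑ l, basisFun L N l p • (Complex.I * freq L N l * profileCoeff L N l)) p := by
  have h : HasDerivAt (profileInterp L N) _ p :=
    HasDerivAt.fun_sum fun l _ => (hasDerivAt_basisFun L N l p).smul_const (profileCoeff L N l)
  refine h.congr_deriv (Finset.sum_congr rfl fun l _ => ?_)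
  simp only [smul_eq_mul]
  ring

theorem sq_integral_le {f : ℝ → ℝ} (hf : Continuous f) {a h : ℝ} (hh : 0 < h) :
    (∫ p in a..(a + h), f p) ^ 2 ≤ h * ∫ p in a..(a + h), f p ^ 2 := by
  set m := (∫ p in a..(a + h), f p) / h with hm
  have hI : (∫ p in a..(a + h), f p) = m * h := by rw [hm]; field_simp
  have h1 : 0 ≤ ∫ p in a..(a + h), (f p - m) ^ 2 :=
    intervalIntegral.integral_nonneg (by linarith) fun p _ => sq_nonneg _
  have h2 : ∫ p in a..(a + h), (f p - m) ^ 2 =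
      (∫ p in a..(a + h), f p ^ 2) - 2 * m * (m * h) + m ^ 2 * h := by
    have e : ∀ p, (f p - m) ^ 2 = f p ^ 2 - 2 * m * f p + m ^ 2 := fun p => by ring
    simp only [e]
    rw [intervalIntegral.integral_add, intervalIntegral.integral_sub,
      intervalIntegral.integral_const_mul, hI, intervalIntegral.integral_const]
    · simp; ring
    all_goals exact Continuous.intervalIntegrable (by fun_prop) _ _
  rw [hI]
  nlinarith

/-- Poincaré inequality on an interval of length `h`, for functions vanishing at the left
endpoint. -/
theorem integral_norm_sq_le_of_left_zero {e e' : ℝ → ℂ} (he : ∀ p, HasDerivAt e (e' p) p)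
    (he' : Continuous e') {a h : ℝ} (hh : 0 < h) (h0 : e a = 0) :
    ∫ p in a..(a + h), ‖e p‖ ^ 2 ≤ h ^ 2 * ∫ p in a..(a + h), ‖e' p‖ ^ 2 := by
  have hcont : Continuous e := continuous_iff_continuousAt.2 fun p => (he p).continuousAt
  have hp : ∀ p ∈ Set.Icc a (a + h), ‖e p‖ ^ 2 ≤ h * ∫ p in a..(a + h), ‖e' p‖ ^ 2 := by
    intro p hp
    have h1 : e p = ∫ q in a..p, e' q := by
      rw [intervalIntegral.integral_eq_sub_of_hasDerivAt (fun q _ => he q)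
        (he'.intervalIntegrable _ _), h0, sub_zero]
    have h2 : ‖e p‖ ≤ ∫ q in a..(a + h), ‖e' q‖ := by
      rw [h1]
      refine (intervalIntegral.norm_integral_le_integral_norm hp.1).trans ?_
      exact intervalIntegral.integral_mono_interval le_rfl hp.1 hp.2
        (Filter.Eventually.of_forall fun q => norm_nonneg _) (he'.norm.intervalIntegrable _ _)
    exact (pow_le_pow_left₀ (norm_nonneg _) h2 2).trans (sq_integral_le he'.norm hh)
  have h3 := intervalIntegral.integral_mono_on (by linarith : a ≤ a + h)
    ((hcont.norm.pow 2).intervalIntegrable (μ := volume) _ _)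
    intervalIntegrable_const hp
  rw [intervalIntegral.integral_const] at h3
  refine h3.trans (le_of_eq ?_)
  simp only [add_sub_cancel_left, smul_eq_mul]
  ring

/-- The interpolation error on `[0, πL]` is of first order in `L²`. -/
theorem integral_interp_error_le {L : ℝ} (hL : 0 < L) {N : ℕ} (hN0 : 0 < N) (hN : Even N) :
    ∫ p in (0 : ℝ)..(π * L), ‖profileInterp L N p - (Real.exp (-p) : ℂ)‖ ^ 2 ≤
      (π ^ 2 + 1) * meshSize L N ^ 2 := by
  have hd : 0 < meshSize L N := by
    have : (0 : ℝ) < N := by exact_mod_cast hN0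
    unfold meshSize
    positivity
  have hmesh := mul_meshSize L hN0
  set v' : ℝ → ℂ := fun p =>
    ∑ l, basisFun L N l p • (Complex.I * freq L N l * profileCoeff L N l) with hv'
  have hv'c : Continuous v' :=
    continuous_finsetSum _ fun l _ => (continuous_basisFun L N l).smul continuous_const
  set e : ℝ → ℂ := fun p => profileInterp L N p - (Real.exp (-p) : ℂ) with he
  have hexpc : Continuous fun p : ℝ => (Real.exp (-p) : ℂ) := by fun_prop
  have hder : ∀ p, HasDerivAt e (v' p + (Real.exp (-p) : ℂ)) p := by
    intro p
    have h1 : HasDerivAt (fun p : ℝ => Real.exp (-p)) (-Real.exp (-p)) p := by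
      simpa using (hasDerivAt_neg p).exp
    refine ((hasDerivAt_profileInterp L N p).sub h1.ofReal_comp).congr_deriv ?_
    rw [Complex.ofReal_neg, sub_neg_eq_add]
  have hec : Continuous fun p => v' p + (Real.exp (-p) : ℂ) := hv'c.add hexpc
  have hcont : Continuous e := (continuous_profileInterp L N).sub hexpc
  obtain ⟨K, rfl⟩ := hN
  set d := meshSize L (K + K)
  have hKd : K * d = π * L := by push_cast at hmesh; linarith
  have hzero : ∀ k < K, e (k * d) = 0 := by
    intro k hk
    have h1 := profileInterp_grid hL hN0 ⟨K, rfl⟩ (show K + k ≤ K + K by omega)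
    have h2 : -(π * L) + (K + k : ℕ) * d = k * d := by
      rw [← hKd]; push_cast; ring
    rw [h2, abs_of_nonneg (by positivity)] at h1
    rw [he]
    simp only
    rw [h1, sub_self]
  have hcell : ∀ k < K, ∫ p in (k * d : ℝ)..((k + 1 : ℕ) * d), ‖e p‖ ^ 2 ≤
      d ^ 2 * ∫ p in (k * d : ℝ)..((k + 1 : ℕ) * d), ‖v' p + (Real.exp (-p) : ℂ)‖ ^ 2 := by
    intro k hk
    have h1 := integral_norm_sq_le_of_left_zero hder hec hd (hzero k hk)
    have h2 : (k : ℝ) * d + d = (k + 1 : ℕ) * d := by push_cast; ring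
    rwa [h2] at h1
  have hsum : ∀ f : ℝ → ℝ, Continuous f →
      ∑ k ∈ Finset.range K, ∫ p in (k * d : ℝ)..((k + 1 : ℕ) * d), f p =
        ∫ p in (0 : ℝ)..(π * L), f p := by
    intro f hf
    rw [intervalIntegral.sum_integral_adjacent_intervals (a := fun k : ℕ => (k : ℝ) * d)
      fun k _ => hf.intervalIntegrable _ _, hKd]
    simp
  have h1 := Finset.sum_le_sum fun k hk => hcell k (Finset.mem_range.1 hk)
  rw [← Finset.mul_sum, hsum (fun p => ‖e p‖ ^ 2) (hcont.norm.pow 2),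
    hsum (fun p => ‖v' p + (Real.exp (-p) : ℂ)‖ ^ 2) (hec.norm.pow 2)] at h1
  refine h1.trans ?_
  rw [mul_comm]
  refine mul_le_mul_of_nonneg_right ?_ (sq_nonneg d)
  have hπL : 0 ≤ π * L := by positivity
  have h2 : ∫ p in (0 : ℝ)..(π * L), ‖v' p + (Real.exp (-p) : ℂ)‖ ^ 2 ≤
      ∫ p in (0 : ℝ)..(π * L), (2 * ‖v' p‖ ^ 2 + 2 * Real.exp (-(2 * p))) := by
    refine intervalIntegral.integral_mono_on hπL ((hec.norm.pow 2).intervalIntegrable _ _)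
      (Continuous.intervalIntegrable (by fun_prop) _ _) fun p _ => ?_
    have h3 := norm_add_le (v' p) (Real.exp (-p) : ℂ)
    have h4 : ‖(Real.exp (-p) : ℂ)‖ = Real.exp (-p) := by
      rw [Complex.norm_real, Real.norm_eq_abs, Real.abs_exp]
    rw [h4] at h3
    have h5 : Real.exp (-(2 * p)) = Real.exp (-p) ^ 2 := by
      rw [← Real.exp_nat_mul]
      congr 1
      push_cast
      ring
    rw [h5]
    nlinarith [pow_le_pow_left₀ (norm_nonneg _) h3 2, sq_nonneg (‖v' p‖ - Real.exp (-p))]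
  have h3 : ∫ p in (0 : ℝ)..(π * L), ‖v' p‖ ^ 2 ≤ π ^ 2 / 2 := by
    have h4 := integral_norm_sq_sum_basisFun hL.ne' (⟨K, rfl⟩ : Even (K + K)) 1 (-(π * L))
      (fun l => Complex.I * freq L (K + K) l * profileCoeff L (K + K) l)
    have h5 := sum_freq_sq_profileCoeff_le hL hN0 ⟨K, rfl⟩
    simp only [Nat.cast_one, one_mul] at h4
    rw [← h4] at h5
    refine le_trans ?_ h5
    exact intervalIntegral.integral_mono_interval (by linarith) hπL (by linarith)
      (Filter.Eventually.of_forall fun q => sq_nonneg _)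
      ((hv'c.norm.pow 2).intervalIntegrable _ _)
  have h4 : ∫ p in (0 : ℝ)..(π * L), 2 * Real.exp (-(2 * p)) ≤ 1 := by
    have h5 : ∀ p : ℝ, HasDerivAt (fun p => -Real.exp (-(2 * p))) (2 * Real.exp (-(2 * p))) p := by
      intro p
      have h6 : HasDerivAt (fun p : ℝ => -(2 * p)) (-2) p := by
        simpa using ((hasDerivAt_id p).const_mul 2).fun_neg
      refine h6.exp.fun_neg.congr_deriv ?_
      ring
    rw [intervalIntegral.integral_eq_sub_of_hasDerivAt (fun p _ => h5 p)
      (Continuous.intervalIntegrable (by fun_prop) _ _)]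
    simp only [mul_zero, neg_zero, Real.exp_zero]
    linarith [Real.exp_pos (-(2 * (π * L)))]
  refine h2.trans ?_
  rw [intervalIntegral.integral_add, intervalIntegral.integral_const_mul]
  · linarith
  all_goals exact Continuous.intervalIntegrable (by fun_prop) _ _

/-! ### The error of the recovered solution -/

theorem IsDiscreteSolution.block_zero {n N : ℕ} {A : ℝ → Matrix (Fin n) (Fin n) ℂ}
    {T L : ℝ} {u₀ : EuclideanSpace ℂ (Fin n)} {w : ℝ → Fin N × Fin n → ℂ}
    (hw : IsDiscreteSolution A T L N u₀ w) (l : Fin N) :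
    block (w 0) l = profileCoeff L N l • u₀ := by
  ext j
  change w 0 (l, j) = profileCoeff L N l * u₀ j
  rw [hw.1, profileCoeff]
  simp only [mulVec, dotProduct, Fintype.sum_prod_type, kroneckerMap_apply, one_apply, initialGrid]
  rw [Finset.sum_mul]
  refine Finset.sum_congr rfl fun k _ => ?_
  simp [mul_assoc]

theorem whd_eq_sum_block {n N : ℕ} (L : ℝ) (w : Fin N × Fin n → ℂ) (p : ℝ) :
    whd L N w p = ∑ l, basisFun L N l p • block w l := rfl

theorem continuous_whd {n N : ℕ} (L : ℝ) (w : Fin N × Fin n → ℂ) : Continuous (whd L N w) :=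
  continuous_finsetSum _ fun l _ => (continuous_basisFun L N l).smul continuous_const

variable {n N : ℕ} {A : ℝ → Matrix (Fin n) (Fin n) ℂ} {T L : ℝ} {u₀ : EuclideanSpace ℂ (Fin n)}
  {u : ℝ → EuclideanSpace ℂ (Fin n)} {w : ℝ → Fin N × Fin n → ℂ}

theorem IsODESolution.norm_le (hT : 0 ≤ T) (hA : ContinuousOn A (Set.Icc 0 T))
    (hu : IsODESolution A T u₀ u) : ‖u T‖ ≤ Real.exp (lamPlus A T * T) * ‖u₀‖ := by
  rw [← hu.1]
  exact norm_le_exp_mul_norm_zero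
    (fun t => inner_toEuclideanCLM_of_isHermitian (isHermitian_H1 (A t)))
    (fun t => inner_I_smul_H2 (A t)) hT (fun t ht => hu.hasDerivWithinAt ht)
    (fun t ht => re_inner_H1_le_lamPlus hA ht)

theorem IsODESolution.norm_initial_le (hT : 0 ≤ T) (hA : ContinuousOn A (Set.Icc 0 T))
    (hu : IsODESolution A T u₀ u) : ‖u₀‖ ≤ Real.exp (lamMinus A T * T) * ‖u T‖ := by
  conv_lhs => rw [← hu.1]
  exact norm_zero_le_exp_mul_norm
    (fun t => inner_toEuclideanCLM_of_isHermitian (isHermitian_H1 (A t)))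
    (fun t => inner_I_smul_H2 (A t)) hT (fun t ht => hu.hasDerivWithinAt ht)
    (fun t ht => neg_lamMinus_le_re_inner_H1 hA ht)

/-- Finite speed of propagation: `w_h^d(t, p) - e^{-p} u(t)` is an exact solution of the continuous
hyperbolic system, so its `L²` norm at time `T` is controlled by the interpolation error of
`e^{-p}` on the domain of dependence. -/
theorem integral_whd_sub_le (hT : 0 ≤ T) (hA : ContinuousOn A (Set.Icc 0 T))
    (hu : IsODESolution A T u₀ u) (hw : IsDiscreteSolution A T L N u₀ w) (q₀ q₁ : ℝ) :
    ∫ p in (q₀ + lamPlus A T * T)..(q₁ - lamMinus A T * T),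
        ‖whd L N (w T) p - (Real.exp (-p) : ℂ) • u T‖ ^ 2 ≤
      (∫ p in q₀..q₁, ‖profileInterp L N p - (Real.exp (-p) : ℂ)‖ ^ 2) * ‖u₀‖ ^ 2 := by
  have hexp : ∀ p : ℝ, HasDerivAt (fun p : ℝ => -(Real.exp (-p) : ℂ))
      (-1 * -(Real.exp (-p) : ℂ)) p := by
    intro p
    have h1 : HasDerivAt (fun p : ℝ => Real.exp (-p)) (-Real.exp (-p)) p := by
      simpa using (hasDerivAt_neg p).exp
    refine h1.ofReal_comp.fun_neg.congr_deriv ?_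
    push_cast
    ring
  -- the extra index `none` carries the separated solution `-e^{-p} u(t)`, with exponent `-1`
  have h := integral_norm_sq_le_of_hyperbolic (ι := Option (Fin N))
    (ψ := fun m => m.elim (fun p : ℝ => -(Real.exp (-p) : ℂ)) fun l => basisFun L N l)
    (ν := fun m => m.elim (-1) fun l => Complex.I * freq L N l)
    (d := fun m t => m.elim (u t) fun l => block (w t) l)
    (S := fun t => toEuclideanCLM (𝕜 := ℂ) (H1 (A t)))
    (K := fun t => Complex.I • toEuclideanCLM (𝕜 := ℂ) (H2 (A t))) (T := T) ?_ hT ?_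
    (fun t => inner_toEuclideanCLM_of_isHermitian (isHermitian_H1 (A t)))
    (fun t => inner_I_smul_H2 (A t)) (fun t ht => re_inner_H1_le_lamPlus hA ht)
    (fun t ht => neg_lamMinus_le_re_inner_H1 hA ht) q₀ q₁
  · simp only [Fintype.sum_option, Option.elim, neg_smul, neg_add_eq_sub,
      ← whd_eq_sum_block] at h
    refine h.trans (le_of_eq ?_)
    rw [← intervalIntegral.integral_mul_const]
    refine intervalIntegral.integral_congr fun p _ => ?_
    have e : whd L N (w 0) p = profileInterp L N p • u₀ := by
      rw [whd_eq_sum_block, profileInterp, Finset.sum_smul]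
      exact Finset.sum_congr rfl fun l _ => by rw [hw.block_zero, smul_assoc]
    simp only [hu.1]
    rw [e, ← sub_smul, norm_smul, mul_pow]
  · rintro (_ | l) p
    · exact hexp p
    · exact hasDerivAt_basisFun L N l p
  · rintro (_ | l) t ht
    · simpa using hu.hasDerivWithinAt ht
    · exact hw.hasDerivWithinAt_block l ht

/-- Each Fourier mode evolves unitarily; counting periods bounds the `L²` norm of `w_h^d(T)` on an
interval of length `R`. -/
theorem integral_whd_le (hT : 0 ≤ T) (hL : 0 < L) (hN0 : 0 < N) (hN : Even N)
    (hw : IsDiscreteSolution A T L N u₀ w) (x : ℝ) {R : ℝ} (hR : 0 ≤ R) :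
    ∫ p in x..(x + R), ‖whd L N (w T) p‖ ^ 2 ≤ (R + 1 + meshSize L N) * ‖u₀‖ ^ 2 := by
  have hP : 0 < 2 * π * L := by positivity
  set m := ⌈R / (2 * π * L)⌉₊
  have hm1 : R ≤ m * (2 * π * L) := (div_le_iff₀ hP).1 (Nat.le_ceil _)
  have hm2 : (m : ℝ) ≤ R / (2 * π * L) + 1 := (Nat.ceil_lt_add_one (by positivity)).le
  set G := ∑ j ∈ Finset.range N, Real.exp (-|-(π * L) + j * meshSize L N|) ^ 2
  have hd : 0 ≤ meshSize L N := by unfold meshSize; positivity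
  have hG0 : 0 ≤ meshSize L N * G :=
    mul_nonneg hd (Finset.sum_nonneg fun _ _ => sq_nonneg _)
  have hG1 : meshSize L N * G ≤ 1 + meshSize L N := meshSize_mul_sum_sq_le hL hN0 hN
  have hG2 : meshSize L N * G ≤ 2 * π * L := by
    rw [← mul_meshSize L hN0, mul_comm]
    refine mul_le_mul_of_nonneg_right ?_ hd
    calc G ≤ ∑ j ∈ Finset.range N, (1 : ℝ) := Finset.sum_le_sum fun j _ =>
          pow_le_one₀ (Real.exp_pos _).le (Real.exp_le_one_iff.2 (neg_nonpos.2 (abs_nonneg _)))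
      _ = N := by simp
  calc ∫ p in x..(x + R), ‖whd L N (w T) p‖ ^ 2
      ≤ ∫ p in x..(x + m * (2 * π * L)), ‖whd L N (w T) p‖ ^ 2 :=
        intervalIntegral.integral_mono_interval le_rfl (by linarith) (by linarith)
          (Filter.Eventually.of_forall fun q => sq_nonneg _)
          (((continuous_whd L (w T)).norm.pow 2).intervalIntegrable _ _)
    _ = m * (2 * π * L) * ∑ l, ‖block (w T) l‖ ^ 2 :=
        integral_norm_sq_sum_basisFun hL.ne' hN m x _
    _ ≤ m * (2 * π * L) * ∑ l, ‖block (w 0) l‖ ^ 2 := by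
        gcongr with l
        exact hw.norm_block_le hT l
    _ = m * (meshSize L N * G) * ‖u₀‖ ^ 2 := by
        rw [← sum_norm_sq_profileCoeff hL hN0 hN]
        simp only [hw.block_zero, norm_smul, mul_pow, ← Finset.sum_mul]
        ring
    _ ≤ (R + 1 + meshSize L N) * ‖u₀‖ ^ 2 := by
        refine mul_le_mul_of_nonneg_right ?_ (sq_nonneg _)
        calc m * (meshSize L N * G) ≤ (R / (2 * π * L) + 1) * (meshSize L N * G) := by gcongr
          _ = R / (2 * π * L) * (meshSize L N * G) + meshSize L N * G := by ring
          _ ≤ R / (2 * π * L) * (2 * π * L) + (1 + meshSize L N) := by gcongr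
          _ = R + 1 + meshSize L N := by field_simp; ring

theorem eLpNorm_two_restrict_Ioo_le {E : Type*} [NormedAddCommGroup E] {f : ℝ → E}
    (hf : Continuous f) {a b B : ℝ} (hab : a ≤ b) (hB : 0 ≤ B)
    (h : ∫ p in a..b, ‖f p‖ ^ 2 ≤ B ^ 2) :
    eLpNorm f 2 (volume.restrict (Set.Ioo a b)) ≤ ENNReal.ofReal B := by
  have hint : Integrable (fun p => ‖f p‖ ^ 2) (volume.restrict (Set.Ioo a b)) :=
    ((hf.norm.pow 2).integrableOn_Icc (a := a) (b := b)).mono_set Set.Ioo_subset_Icc_self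
  have hmem : MemLp f 2 (volume.restrict (Set.Ioo a b)) :=
    (memLp_two_iff_integrable_sq_norm hf.aestronglyMeasurable).2 hint
  rw [hmem.eLpNorm_eq_integral_rpow_norm (by norm_num) (by norm_num)]
  refine ENNReal.ofReal_le_ofReal ?_
  simp only [ENNReal.toReal_ofNat, Real.rpow_ofNat]
  rw [← integral_Ioc_eq_integral_Ioo, ← intervalIntegral.integral_of_le hab,
    show (2 : ℝ)⁻¹ = 1 / 2 by norm_num, ← Real.sqrt_eq_rpow]
  exact Real.sqrt_le_iff.2 ⟨hB, h⟩

theorem continuous_uhd_sub (L : ℝ) (w : Fin N × Fin n → ℂ) (v : EuclideanSpace ℂ (Fin n)) :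
    Continuous fun p => uhd L N w p - v := by
  have h : Continuous fun p : ℝ => (Real.exp p : ℂ) := by fun_prop
  exact (h.smul (continuous_whd L w)).sub continuous_const

/-- The case in which the domain of dependence of `(pD, pD + R)` stays inside `[0, πL]`. -/
theorem integral_uhd_sub_le_of_le (hT : 0 ≤ T) (hA : ContinuousOn A (Set.Icc 0 T)) (hL : 0 < L)
    (hN0 : 0 < N) (hN : Even N) (hu : IsODESolution A T u₀ u)
    (hw : IsDiscreteSolution A T L N u₀ w) {R pD : ℝ} (hR : 0 ≤ R) (hpD : lamPlus A T * T ≤ pD)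
    (h : pD + R + lamMinus A T * T ≤ π * L) :
    ∫ p in pD..(pD + R), ‖uhd L N (w T) p - u T‖ ^ 2 ≤
      (Real.exp (pD + R) * ((π + 1) * meshSize L N) * ‖u₀‖) ^ 2 := by
  have hlm : 0 ≤ lamMinus A T * T := mul_nonneg (le_max_right _ _) hT
  have hlp : 0 ≤ lamPlus A T * T := mul_nonneg (le_max_right _ _) hT
  have h1 := integral_whd_sub_le hT hA hu hw (pD - lamPlus A T * T) (pD + R + lamMinus A T * T)
  rw [sub_add_cancel, add_sub_cancel_right] at h1
  have hexpc : Continuous fun p : ℝ => (Real.exp (-p) : ℂ) := by fun_prop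
  have hc : Continuous fun p => whd L N (w T) p - (Real.exp (-p) : ℂ) • u T :=
    (continuous_whd L (w T)).sub (hexpc.smul continuous_const)
  have h2 : ∫ p in (pD - lamPlus A T * T)..(pD + R + lamMinus A T * T),
      ‖profileInterp L N p - (Real.exp (-p) : ℂ)‖ ^ 2 ≤ (π ^ 2 + 1) * meshSize L N ^ 2 :=
    (intervalIntegral.integral_mono_interval (by linarith) (by linarith) h
      (Filter.Eventually.of_forall fun q => sq_nonneg _)
      ((((continuous_profileInterp L N).sub hexpc).norm.pow 2).intervalIntegrable _ _)).trans
      (integral_interp_error_le hL hN0 hN)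
  have h3 : ∀ p ∈ Set.Icc pD (pD + R), ‖uhd L N (w T) p - u T‖ ^ 2 ≤
      Real.exp (pD + R) ^ 2 * ‖whd L N (w T) p - (Real.exp (-p) : ℂ) • u T‖ ^ 2 := by
    intro p hp
    have e : uhd L N (w T) p - u T =
        (Real.exp p : ℂ) • (whd L N (w T) p - (Real.exp (-p) : ℂ) • u T) := by
      rw [smul_sub, smul_smul, ← Complex.ofReal_mul, ← Real.exp_add, add_neg_cancel, Real.exp_zero,
        Complex.ofReal_one, one_smul, uhd]
    rw [e, norm_smul, mul_pow, Complex.norm_real, Real.norm_eq_abs, Real.abs_exp]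
    have := Real.exp_le_exp.2 hp.2
    gcongr
  calc ∫ p in pD..(pD + R), ‖uhd L N (w T) p - u T‖ ^ 2
      ≤ ∫ p in pD..(pD + R),
          Real.exp (pD + R) ^ 2 * ‖whd L N (w T) p - (Real.exp (-p) : ℂ) • u T‖ ^ 2 :=
        intervalIntegral.integral_mono_on (by linarith)
          (((continuous_uhd_sub L (w T) (u T)).norm.pow 2).intervalIntegrable _ _)
          (((hc.norm.pow 2).const_mul _).intervalIntegrable _ _) h3
    _ ≤ Real.exp (pD + R) ^ 2 * (((π ^ 2 + 1) * meshSize L N ^ 2) * ‖u₀‖ ^ 2) := by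
        rw [intervalIntegral.integral_const_mul]
        gcongr
        exact h1.trans (mul_le_mul_of_nonneg_right h2 (sq_nonneg _))
    _ ≤ Real.exp (pD + R) ^ 2 * (((π + 1) ^ 2 * meshSize L N ^ 2) * ‖u₀‖ ^ 2) := by
        gcongr
        nlinarith [Real.pi_pos]
    _ = _ := by ring

/-- A bound without smallness, from the unitarity of the discrete evolution alone. -/
theorem integral_uhd_sub_le (hT : 0 ≤ T) (hL : 0 < L) (hN0 : 0 < N) (hN : Even N)
    (hw : IsDiscreteSolution A T L N u₀ w) (v : EuclideanSpace ℂ (Fin n)) {R : ℝ} (hR : 1 ≤ R)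
    (x : ℝ) :
    ∫ p in x..(x + R), ‖uhd L N (w T) p - v‖ ^ 2 ≤
      (2 * (R + 1) * (Real.exp (x + R) * (1 + meshSize L N) * ‖u₀‖ + ‖v‖)) ^ 2 := by
  have hd : 0 ≤ meshSize L N := by unfold meshSize; positivity
  have h1 := integral_whd_le hT hL hN0 hN hw x (by linarith : 0 ≤ R)
  have hc : Continuous fun p => ‖whd L N (w T) p‖ ^ 2 := (continuous_whd L (w T)).norm.pow 2
  have h3 : ∀ p ∈ Set.Icc x (x + R), ‖uhd L N (w T) p - v‖ ^ 2 ≤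
      2 * Real.exp (x + R) ^ 2 * ‖whd L N (w T) p‖ ^ 2 + 2 * ‖v‖ ^ 2 := by
    intro p hp
    have h4 := norm_sub_le (uhd L N (w T) p) v
    have h5 : ‖uhd L N (w T) p‖ ≤ Real.exp (x + R) * ‖whd L N (w T) p‖ := by
      rw [uhd, norm_smul, Complex.norm_real, Real.norm_eq_abs, Real.abs_exp]
      have := Real.exp_le_exp.2 hp.2
      gcongr
    have h6 := pow_le_pow_left₀ (norm_nonneg _) (h4.trans (add_le_add_left h5 _)) 2
    nlinarith [sq_nonneg (Real.exp (x + R) * ‖whd L N (w T) p‖ - ‖v‖)]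
  calc ∫ p in x..(x + R), ‖uhd L N (w T) p - v‖ ^ 2
      ≤ ∫ p in x..(x + R), (2 * Real.exp (x + R) ^ 2 * ‖whd L N (w T) p‖ ^ 2 + 2 * ‖v‖ ^ 2) :=
        intervalIntegral.integral_mono_on (by linarith)
          (((continuous_uhd_sub L (w T) v).norm.pow 2).intervalIntegrable _ _)
          (((hc.const_mul _).add continuous_const).intervalIntegrable _ _) h3
    _ = 2 * Real.exp (x + R) ^ 2 * (∫ p in x..(x + R), ‖whd L N (w T) p‖ ^ 2)
          + R * (2 * ‖v‖ ^ 2) := by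
        rw [intervalIntegral.integral_add ((hc.const_mul _).intervalIntegrable _ _)
          intervalIntegrable_const, intervalIntegral.integral_const_mul,
          intervalIntegral.integral_const]
        simp
    _ ≤ 2 * Real.exp (x + R) ^ 2 * ((R + 1 + meshSize L N) * ‖u₀‖ ^ 2) + R * (2 * ‖v‖ ^ 2) := by
        gcongr
    _ ≤ 2 * Real.exp (x + R) ^ 2 * ((R + 1) * (1 + meshSize L N) ^ 2 * ‖u₀‖ ^ 2)
          + (R + 1) * (2 * ‖v‖ ^ 2) := by
        gcongr
        · nlinarith [mul_nonneg (by linarith : 0 ≤ R) hd, sq_nonneg (meshSize L N),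
            mul_nonneg (by linarith : 0 ≤ R) (sq_nonneg (meshSize L N))]
        · linarith
    _ = 2 * (R + 1) * ((Real.exp (x + R) * (1 + meshSize L N) * ‖u₀‖) ^ 2 + ‖v‖ ^ 2) := by ring
    _ ≤ (2 * (R + 1)) ^ 2 * (Real.exp (x + R) * (1 + meshSize L N) * ‖u₀‖ + ‖v‖) ^ 2 := by
        have hX : 0 ≤ Real.exp (x + R) * (1 + meshSize L N) * ‖u₀‖ := by positivity
        gcongr
        · nlinarith
        · nlinarith [mul_nonneg hX (norm_nonneg v)]
    _ = _ := by ring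

end Schrodingerization

theorem theorem4p4 (M Λ : ℝ) :
    ∃ C : ℝ, 0 < C ∧
      ∀ (n N : ℕ) (A : ℝ → Matrix (Fin n) (Fin n) ℂ) (T L R ε pD : ℝ)
        (u₀ : EuclideanSpace ℂ (Fin n)) (u : ℝ → EuclideanSpace ℂ (Fin n))
        (w : ℝ → Fin N × Fin n → ℂ),
        0 < T → ContinuousOn A (Set.Icc 0 T) →
        0 < N → Even N → 0 < L →
        Schrodingerization.lamMinus A T * T ≤ Λ →
        1 ≤ R → Real.exp R ≤ M →
        Schrodingerization.lamPlus A T * T ≤ pD →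
        Real.exp (pD - Schrodingerization.lamPlus A T * T) ≤ M →
        Real.exp (-(Real.pi * L) + 2 * Schrodingerization.lamPlus A T * T + R) ≤ ε →
        Real.exp (-(Real.pi * L) + Schrodingerization.lamMinus A T * T
          + Schrodingerization.lamPlus A T * T + R) ≤ ε →
        Schrodingerization.IsODESolution A T u₀ u →
        Schrodingerization.IsDiscreteSolution A T L N u₀ w →
        MeasureTheory.eLpNorm (fun p : ℝ => Schrodingerization.uhd L N (w T) p - u T) 2
            (MeasureTheory.volume.restrict (Set.Ioo pD (pD + R)))
          ≤ ENNReal.ofReal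
              (C * (Schrodingerization.meshSize L N * Real.exp pD * ‖u T‖ + ε * ‖u₀‖)) := by
  open Schrodingerization in
  set Q : ℝ := Real.exp Λ
  have hQ : 0 < Q := Real.exp_pos Λ
  -- the two main summands come from the two positions of the domain of dependence; `|M|` makes the
  -- constant positive also for those `M` that no `R ≥ 1` satisfies
  refine ⟨(π + 1) * (|M| * Q) + 2 * (|M| + 1) * (|M| * Q + |M| ^ 3 * Q + |M| * Q) + 1, by positivity,
    ?_⟩
  intro n N A T L R ε pD u₀ u w hT hA hN0 hN hL hΛ hR hRM hpD hpM hε1 _ hu hw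
  have hM : 0 < M := (Real.exp_pos R).trans_le hRM
  rw [abs_of_pos hM]
  have hRle : R ≤ M := by linarith [Real.add_one_le_exp R]
  set h := meshSize L N
  have hd : 0 ≤ h := by unfold h meshSize; positivity
  have hε : 0 ≤ ε := (Real.exp_pos _).le.trans hε1
  have hu1 : ‖u₀‖ ≤ Q * ‖u T‖ := (hu.norm_initial_le hT.le hA).trans
    (mul_le_mul_of_nonneg_right (Real.exp_le_exp.2 hΛ) (norm_nonneg _))
  have hpR : Real.exp (pD + R) ≤ Real.exp pD * M := by rw [Real.exp_add]; gcongr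
  refine eLpNorm_two_restrict_Ioo_le (continuous_uhd_sub L (w T) (u T)) (by linarith)
    (by positivity) ?_
  set X := h * Real.exp pD * ‖u T‖
  set Y := ε * ‖u₀‖
  have hX : 0 ≤ X := by positivity
  have hY : 0 ≤ Y := by positivity
  have hh : Real.exp (pD + R) * h * ‖u₀‖ ≤ M * Q * X := by
    calc Real.exp (pD + R) * h * ‖u₀‖ ≤ (Real.exp pD * M) * h * (Q * ‖u T‖) := by gcongr
      _ = M * Q * X := by ring
  rcases le_or_gt (pD + R + lamMinus A T * T) (π * L) with hcase | hcase
  · refine (integral_uhd_sub_le_of_le hT.le hA hL hN0 hN hu hw (by linarith) hpD hcase).trans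
      (pow_le_pow_left₀ (by positivity) ?_ 2)
    calc Real.exp (pD + R) * ((π + 1) * h) * ‖u₀‖
        = (π + 1) * (Real.exp (pD + R) * h * ‖u₀‖) := by ring
      _ ≤ (π + 1) * (M * Q * X) := by gcongr
      _ = (π + 1) * (M * Q) * X := by ring
      _ ≤ _ := by
        gcongr
        · have : 0 ≤ 2 * (M + 1) * (M * Q + M ^ 3 * Q + M * Q) + 1 := by positivity
          linarith
        · linarith
  · -- the interval reaches the boundary of the period, so `ε` is comparable to `e^{λ⁺ T}`
    have hlam : Real.exp (lamPlus A T * T) ≤ M * Q * ε := by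
      calc Real.exp (lamPlus A T * T)
          = Real.exp (pD - lamPlus A T * T) * Real.exp (lamMinus A T * T)
            * Real.exp (2 * lamPlus A T * T - pD - lamMinus A T * T) := by
            rw [← Real.exp_add, ← Real.exp_add]
            congr 1
            ring
        _ ≤ M * Q * ε := by
            have hQ' : Real.exp (lamMinus A T * T) ≤ Q := Real.exp_le_exp.2 hΛ
            gcongr
            refine le_trans (Real.exp_le_exp.2 ?_) hε1
            linarith
    have h1 : Real.exp (pD + R) * ‖u₀‖ ≤ M ^ 3 * Q * Y := by
      have e : Real.exp pD = Real.exp (pD - lamPlus A T * T) * Real.exp (lamPlus A T * T) := by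
        rw [← Real.exp_add, sub_add_cancel]
      calc Real.exp (pD + R) * ‖u₀‖ ≤ (Real.exp pD * M) * ‖u₀‖ := by gcongr
        _ ≤ (M * (M * Q * ε) * M) * ‖u₀‖ := by rw [e]; gcongr
        _ = M ^ 3 * Q * Y := by ring
    have h2 : ‖u T‖ ≤ M * Q * Y := by
      calc ‖u T‖ ≤ Real.exp (lamPlus A T * T) * ‖u₀‖ := hu.norm_le hT.le hA
        _ ≤ M * Q * ε * ‖u₀‖ := by gcongr
        _ = M * Q * Y := by ring
    refine (integral_uhd_sub_le hT.le hL hN0 hN hw (u T) hR pD).trans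
      (pow_le_pow_left₀ (by positivity) ?_ 2)
    calc 2 * (R + 1) * (Real.exp (pD + R) * (1 + h) * ‖u₀‖ + ‖u T‖)
        = 2 * (R + 1) * (Real.exp (pD + R) * h * ‖u₀‖ + Real.exp (pD + R) * ‖u₀‖ + ‖u T‖) := by
          ring
      _ ≤ 2 * (M + 1) * (M * Q * X + M ^ 3 * Q * Y + M * Q * Y) := by gcongr
      _ ≤ 2 * (M + 1) * (M * Q * (X + Y) + M ^ 3 * Q * (X + Y) + M * Q * (X + Y)) := by
          gcongr <;> linarith
      _ = 2 * (M + 1) * (M * Q + M ^ 3 * Q + M * Q) * (X + Y) := by ring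
      _ ≤ _ := by
        gcongr
        have : 0 ≤ (π + 1) * (M * Q) := by positivity
        linarith
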